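/- Let $\rho=e^{2\pi i/3}$ and $\tau=\frac{1+\sqrt5}{2}$, and let $\mathcal V\subset \mathrm{PGL}_3(\mathbb C)$ be the Valentiner group (isomorphic to $A_6$), generated by the classes of $$Z_1=\begin{pmatrix}1&0&0\\0&-1&0\\0&0&-1\end{pmatrix},\quad T_1=\begin{pmatrix}0&0&1\\1&0&0\\0&1&0\end{pmatrix},\quad P=\frac12\begin{pmatrix}1&\tau^{-1}&-\tau\\ \tau^{-1}&\tau&1\\ \tau&-1&\tau^{-1}\end{pmatrix},\quad Q=\begin{pmatrix}1&0&0\\0&0&\rho^2\\0&-\rho&0\end{pmatrix}.$$ Let $\mathcal V_{3\cdot360}$ (respectively $\mathcal V_{6\cdot360}$) be the group of all unitary $3\times3$ matrices with determinant $1$ (respectively $\pm1$) whose class in $\mathrm{PGL}_3(\mathbb C)$ lies in $\mathcal V$. A finite group $\mathcal G\subset \mathrm{GL}_n(\mathbb C)$ acts on polynomials and on polynomial differential forms on $\mathbb C^n$ by $(T\alpha)(x)=\alpha(T^{-1}x)$, that is, by pull-back along $T^{-1}$. Let $\mathbb C[x]_m^{\mathcal G}$ be the space of $\mathcal G$-invariant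 homogeneous polynomials of degree $m$, and let $\Lambda_p(\mathbb C^n)_m^{\mathcal G}$ be the space of $\mathcal G$-invariant $p$-forms whose coefficients are homogeneous polynomials of degree $m$. Define the invariant and the exterior Molien series by $$M(\Lambda_0^{\mathcal G})=\sum_{m\ge0}\bigl(\dim \mathbb C[x]_m^{\mathcal G}\bigr)t^m,\qquad M(\Lambda^{\mathcal G})=\sum_{p=0}^{n}\Bigl(\sum_{m\ge0}\bigl(\dim\Lambda_p(\mathbb C^n)_m^{\mathcal G}\bigr)t^m\Bigr)s^p .$$ **Proposition (exterior Molien quotient).** The power series $M(\Lambda_0^{\mathcal V_{6\cdot360}})$ is invertible, and $$\frac{M(\Lambda^{\mathcal V_{3\cdot360}})}{M(\Lambda_0^{\mathcal V_{6\cdot360}})}=(1+t^{45})+(t^5+t^{11}+t^{20}+t^{26}+t^{29}+t^{44})\,s+(t+t^{16}+t^{19}+t^{25}+t^{34}+t^{40})\,s^2+(1+t^{45})\,s^3 .$$ In particular this quotient is a polynomial in $s$ and $t$, and it shows a duality between $p$-forms and $(3-p)$-forms centred on degree $45$: for all $0\le p\le3$ and $0\le a\le45$ its coefficient of $s^pt^a$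 equals its coefficient of $s^{3-p}t^{45-a}$. -/

import Mathlib

open scoped MatrixGroups

namespace Valentiner

noncomputable section

/-! ### Invariant forms and Molien series -/

/-- The substitution `f ↦ f(A x)` on complex polynomials in `n` variables. -/
def polySubst {n : ℕ} (A : Matrix (Fin n) (Fin n) ℂ) :
    MvPolynomial (Fin n) ℂ →ₐ[ℂ] MvPolynomial (Fin n) ℂ :=
  MvPolynomial.aeval fun i => ∑ j, MvPolynomial.C (A i j) * MvPolynomial.X j

/-- `ℂ[x]_m^G`: the homogeneous polynomials `f` of degree `m` with
`f(T⁻¹ x) = f(x)` for all `T ∈ G`. -/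
def invariantPolys {n : ℕ} (G : Subgroup (GL (Fin n) ℂ)) (m : ℕ) :
    Submodule ℂ (MvPolynomial (Fin n) ℂ) where
  carrier := {f | f ∈ MvPolynomial.homogeneousSubmodule (Fin n) ℂ m ∧
    ∀ T ∈ G, polySubst ((T⁻¹ : GL (Fin n) ℂ) : Matrix (Fin n) (Fin n) ℂ) f = f}
  zero_mem' := ⟨Submodule.zero_mem _, fun _ _ => map_zero _⟩
  add_mem' := fun ha hb => ⟨Submodule.add_mem _ ha.1 hb.1, fun T hT => by
    rw [map_add, ha.2 T hT, hb.2 T hT]⟩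
  smul_mem' := fun c _ ha => ⟨Submodule.smul_mem _ c ha.1, fun T hT => by
    rw [map_smul, ha.2 T hT]⟩

/-- The Molien series `M(ℂ[x]^G) = ∑ₘ (dim ℂ[x]_m^G) t^m`. -/
def molienSeries {n : ℕ} (G : Subgroup (GL (Fin n) ℂ)) : PowerSeries ℚ :=
  PowerSeries.mk fun m => (Module.finrank ℂ (invariantPolys G m) : ℚ)

/-- Differential `p`-forms on `ℂⁿ` with polynomial coefficients: alternating `p`-linear maps on
`ℂⁿ` with values in the polynomial ring. The form `f dx_{i₁} ∧ ⋯ ∧ dx_{i_p}` is the map that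
sends `(v₁, …, v_p)` to `f · det((v_k)_{i_l})`. -/
abbrev PolyForm (n p : ℕ) : Type :=
  (Fin n → ℂ) [⋀^Fin p]→ₗ[ℂ] MvPolynomial (Fin n) ℂ

/-- The pull-back of a form under the linear map `x ↦ A x`:
`(A^* ω)_x (v₁, …, v_p) = ω_{A x} (A v₁, …, A v_p)`. -/
def formPullback {n p : ℕ} (A : Matrix (Fin n) (Fin n) ℂ) (ω : PolyForm n p) : PolyForm n p :=
  (polySubst A).toLinearMap.compAlternatingMap (ω.compLinearMap A.mulVecLin)

/-- `Λ_p(ℂⁿ)_m^G`: the `p`-forms, with coefficients homogeneous of degree `m`, that are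
invariant under the action `T · ω = (T⁻¹)^* ω` of `G`. -/
def invariantForms {n : ℕ} (G : Subgroup (GL (Fin n) ℂ)) (p m : ℕ) :
    Submodule ℂ (PolyForm n p) where
  carrier := {ω | (∀ v, ω v ∈ MvPolynomial.homogeneousSubmodule (Fin n) ℂ m) ∧
    ∀ T ∈ G, formPullback ((T⁻¹ : GL (Fin n) ℂ) : Matrix (Fin n) (Fin n) ℂ) ω = ω}
  zero_mem' := ⟨fun _ => Submodule.zero_mem _, fun _ _ => by
    ext v; simp [formPullback]⟩
  add_mem' := fun {a b} ha hb => ⟨fun v => Submodule.add_mem _ (ha.1 v) (hb.1 v), fun T hT => by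
    conv_rhs => rw [← ha.2 T hT, ← hb.2 T hT]
    ext v; simp [formPullback]⟩
  smul_mem' := fun c a ha => ⟨fun v => Submodule.smul_mem _ c (ha.1 v), fun T hT => by
    conv_rhs => rw [← ha.2 T hT]
    ext v; simp [formPullback]⟩

/-- The exterior Molien series `M(Λ^G) = ∑_{p=0}^n (∑ₘ (dim Λ_p(ℂⁿ)_m^G) t^m) s^p`, a polynomial
in `s` over the power series in `t`. -/
def exteriorMolienSeries {n : ℕ} (G : Subgroup (GL (Fin n) ℂ)) :
    Polynomial (PowerSeries ℚ) :=
  ∑ p ∈ Finset.range (n + 1),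
    Polynomial.C (PowerSeries.mk fun m => (Module.finrank ℂ (invariantForms G p m) : ℚ)) *
      Polynomial.X ^ p

/-! ### The Valentiner group and its linear lifts -/

/-- The primitive cube root of unity `ρ = e^{2πi/3}`. -/
def rho : ℂ := Complex.exp (2 * Real.pi * Complex.I / 3)

/-- The golden ratio `τ = (1 + √5)/2`, as a complex number. -/
def tau : ℂ := (Real.goldenRatio : ℂ)

theorem rho_pow_three : rho ^ 3 = 1 := by
  rw [rho, ← Complex.exp_nat_mul]
  convert Complex.exp_two_pi_mul_I using 2
  push_cast; ring

theorem tau_sq : tau ^ 2 = tau + 1 := by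
  have h := Real.goldenRatio_sq
  unfold tau
  exact_mod_cast h

theorem tau_ne_zero : tau ≠ 0 := by
  have h := Real.goldenRatio_ne_zero
  unfold tau
  exact_mod_cast h

/-- The involution `Z₁`. -/
def matZ : Matrix (Fin 3) (Fin 3) ℂ := !![1, 0, 0; 0, -1, 0; 0, 0, -1]

/-- The order three rotation `T₁`. Together, `Z₁` and `T₁` generate the tetrahedral group: the
twelve matrices of determinant one obtained from the powers of `T₁` by changing signs of rows. -/
def matT : Matrix (Fin 3) (Fin 3) ℂ := !![0, 0, 1; 1, 0, 0; 0, 1, 0]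

/-- The order five rotation `P` that extends the tetrahedral group to an icosahedral group. -/
def matP : Matrix (Fin 3) (Fin 3) ℂ :=
  !![1 / 2, tau⁻¹ / 2, -tau / 2; tau⁻¹ / 2, tau / 2, 1 / 2; tau / 2, -1 / 2, tau⁻¹ / 2]

/-- The order four element `Q` that extends the tetrahedral group to an octahedral group. -/
def matQ : Matrix (Fin 3) (Fin 3) ℂ := !![1, 0, 0; 0, 0, rho ^ 2; 0, -rho, 0]

theorem det_matZ : matZ.det = 1 := by
  simp [matZ, Matrix.det_fin_three]

theorem det_matT : matT.det = 1 := by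
  simp [matT, Matrix.det_fin_three]

theorem det_matP : matP.det = 1 := by
  have h := tau_sq
  have h0 := tau_ne_zero
  have hi : tau⁻¹ = tau - 1 := by
    field_simp
    linear_combination -h
  simp only [matP, Matrix.det_fin_three, hi]
  simp
  linear_combination (3 / 4) * h

theorem det_matQ : matQ.det = 1 := by
  have h := rho_pow_three
  simp [matQ, Matrix.det_fin_three]
  linear_combination h

/-- An element of `GL₃(ℂ)` from a matrix of determinant one. -/
def toGL (A : Matrix (Fin 3) (Fin 3) ℂ) (h : A.det = 1) : GL (Fin 3) ℂ :=
  Matrix.GeneralLinearGroup.mkOfDetNeZero A (h ▸ one_ne_zero)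

/-- The Valentiner group `𝒱 = ⟨Z₁, T₁, P, Q⟩ ⊂ PGL₃(ℂ)`. -/
def valentinerGroup : Subgroup PGL(3, ℂ) :=
  Subgroup.closure
    {Matrix.ProjGenLinGroup.mk (toGL matZ det_matZ),
     Matrix.ProjGenLinGroup.mk (toGL matT det_matT),
     Matrix.ProjGenLinGroup.mk (toGL matP det_matP),
     Matrix.ProjGenLinGroup.mk (toGL matQ det_matQ)}

/-- The group of all unitary `T ∈ GL₃(ℂ)` with determinant in `D` whose projective class lies
in `H`. -/
def unitaryLift (H : Subgroup PGL(3, ℂ)) (D : Subgroup ℂˣ) : Subgroup (GL (Fin 3) ℂ) where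
  carrier := {T | (T : Matrix (Fin 3) (Fin 3) ℂ) ∈ Matrix.unitaryGroup (Fin 3) ℂ ∧
    Matrix.GeneralLinearGroup.det T ∈ D ∧ Matrix.ProjGenLinGroup.mk T ∈ H}
  one_mem' := ⟨one_mem _, by rw [map_one]; exact one_mem _, by rw [map_one]; exact one_mem _⟩
  mul_mem' := fun ha hb => ⟨by rw [Units.val_mul]; exact mul_mem ha.1 hb.1,
    by rw [map_mul]; exact mul_mem ha.2.1 hb.2.1, by rw [map_mul]; exact mul_mem ha.2.2 hb.2.2⟩
  inv_mem' := fun {a} ha => ⟨by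
      have h := Unitary.star_mem ha.1
      have e : ((a⁻¹ : GL (Fin 3) ℂ) : Matrix (Fin 3) (Fin 3) ℂ) =
          star (a : Matrix (Fin 3) (Fin 3) ℂ) :=
        Units.inv_eq_of_mul_eq_one_left (Unitary.star_mul_self_of_mem ha.1)
      rw [e]; exact h,
    by rw [map_inv]; exact inv_mem ha.2.1, by rw [map_inv]; exact inv_mem ha.2.2⟩

/-- `𝒱_{3·360}`: the 1-to-3 lift of the Valentiner group to `SU₃`. -/
def valentiner3 : Subgroup (GL (Fin 3) ℂ) := unitaryLift valentinerGroup ⊥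

/-- `𝒱_{6·360}`: the 1-to-6 lift of the Valentiner group to unitary matrices with determinant
`±1`. -/
def valentiner6 : Subgroup (GL (Fin 3) ℂ) :=
  unitaryLift valentinerGroup (Subgroup.zpowers (-1))

/-! ### The exterior Molien quotient -/

/-- The exterior Molien quotient `M(Λ^{𝒱_{3·360}}) / M(Λ_0^{𝒱_{6·360}})`, with the denominator
the Molien series of the invariant polynomials of `𝒱_{6·360}`. -/
def exteriorMolienQuotient : Polynomial (PowerSeries ℚ) :=
  exteriorMolienSeries valentiner3 * Polynomial.C (molienSeries valentiner6)⁻¹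

end

end Valentiner

namespace Valentiner

noncomputable section

/-! ### The representation on forms with homogeneous coefficients -/

/-! A scalar `u` acts on `p`-forms of degree `m` by `u ^ (-(m + p))`. The group `valentiner3`
contains `ρ`, so it has no nonzero invariant forms unless `3 ∣ m + p`; in that case its centre acts
trivially and the representation factors through the Valentiner group of order 360. The dimension of
the invariants is then the average of the character over 360 representatives.

The order of the group is never computed. Instead `valentiner_group_algebra` forms the sum `A` of
360 explicit products: an icosahedral group (five powers of `P` times the twelve tetrahedral
elements) and five further cosets `P ^ a * Q` of it. Relations between the generators show that left
multiplication by each generator fixes `A`, so `A / 360` projects onto the invariants and its trace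
is their dimension (`finrank_fixed_eq`). Cyclicity of the trace reduces the 300 elements outside the
icosahedral group to 60.

A special unitary matrix with trace `c` is diagonalizable, with characteristic coefficients `c`,
`star c`, `1`; hence its trace on the forms is the coefficient of `t ^ m` in `extChar p c / det(1 -
t A)` (`trace_homPullback_of_unitary`). Up to powers of `ρ`, which do not matter when `3 ∣ m + p`,
the traces 3, -1, 0, 1, τ, 1 - τ occur 1, 45, 80, 90, 72, 72 times (`charSum`).

Multiplying the resulting series by `(1 - t⁶)(1 - t¹²)(1 - t³⁰)` gives polynomials, and keeping the
degrees `m ≡ -p` modulo 3 yields the four numerators. The group `valentiner6` adds only `-1`, which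
selects the even degrees: the even part of `1 + t⁴⁵` is `1`, so its Molien series is exactly the
inverse of that denominator. The duality is then read off the numerators. -/

theorem polySubst_X {n : ℕ} (A : Matrix (Fin n) (Fin n) ℂ) (i : Fin n) :
    polySubst A (MvPolynomial.X i) = ∑ j, MvPolynomial.C (A i j) * MvPolynomial.X j := by
  simp [polySubst]

theorem polySubst_comp {n : ℕ} (A B : Matrix (Fin n) (Fin n) ℂ) :
    (polySubst B).comp (polySubst A) = polySubst (A * B) := by
  ext1 i
  simp only [AlgHom.comp_apply, polySubst_X, map_sum, map_mul, MvPolynomial.algHom_C,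
    MvPolynomial.algebraMap_eq, Matrix.mul_apply, Finset.mul_sum, Finset.sum_mul]
  rw [Finset.sum_comm]
  simp [mul_assoc]

theorem polySubst_polySubst {n : ℕ} (A B : Matrix (Fin n) (Fin n) ℂ)
    (f : MvPolynomial (Fin n) ℂ) : polySubst B (polySubst A f) = polySubst (A * B) f :=
  DFunLike.congr_fun (polySubst_comp A B) f

theorem polySubst_diagonal_monomial {n : ℕ} (D : Fin n → ℂ) (d : Fin n →₀ ℕ) :
    polySubst (Matrix.diagonal D) (MvPolynomial.monomial d 1) =
      (∏ i, D i ^ d i) • MvPolynomial.monomial d 1 := by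
  have h (i : Fin n) : polySubst (Matrix.diagonal D) (MvPolynomial.X i) =
      MvPolynomial.C (D i) * MvPolynomial.X i := by
    rw [polySubst_X, Finset.sum_eq_single i] <;> simp +contextual [eq_comm]
  rw [MvPolynomial.monomial_eq, Finsupp.prod_fintype _ _ (by simp)]
  simp only [map_mul, map_prod, map_pow, h, mul_pow, Finset.prod_mul_distrib]
  simp [MvPolynomial.smul_eq_C_mul]

theorem polySubst_scalar {n m : ℕ} (c : ℂ) {f : MvPolynomial (Fin n) ℂ}
    (hf : f.IsHomogeneous m) : polySubst (Matrix.scalar (Fin n) c) f = c ^ m • f := by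
  conv_lhs => rw [f.as_sum]
  conv_rhs => rw [f.as_sum]
  rw [map_sum, Finset.smul_sum]
  refine Finset.sum_congr rfl fun d hd => ?_
  have h1 : MvPolynomial.monomial d (f.coeff d) =
      f.coeff d • MvPolynomial.monomial d (1 : ℂ) := by simp [MvPolynomial.smul_monomial]
  rw [h1, map_smul, Matrix.scalar_apply, polySubst_diagonal_monomial, Finset.prod_pow_eq_pow_sum,
    ← Finsupp.degree_eq_sum, Finsupp.degree_eq_weight_one]
  rw [show Finsupp.weight (fun _ => 1) d = m from hf (MvPolynomial.mem_support_iff.1 hd),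
    smul_comm]

theorem polySubst_isHomogeneous {n m : ℕ} (A : Matrix (Fin n) (Fin n) ℂ)
    {f : MvPolynomial (Fin n) ℂ} (hf : f.IsHomogeneous m) : (polySubst A f).IsHomogeneous m := by
  have h := hf.aeval (fun i => ∑ j, MvPolynomial.C (A i j) * MvPolynomial.X j) (n := 1) fun i =>
    MvPolynomial.IsHomogeneous.sum _ _ _ fun j _ => MvPolynomial.isHomogeneous_C_mul_X (A i j) j
  rwa [one_mul] at h

/-- The pull-back as a linear map. -/
def pullbackLin {n : ℕ} (p : ℕ) (A : Matrix (Fin n) (Fin n) ℂ) :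
    PolyForm n p →ₗ[ℂ] PolyForm n p where
  toFun := formPullback A
  map_add' a b := by ext v; simp [formPullback]
  map_smul' c a := by ext v; simp [formPullback]

theorem formPullback_apply {n p : ℕ} (A : Matrix (Fin n) (Fin n) ℂ) (ω : PolyForm n p)
    (v : Fin p → Fin n → ℂ) :
    formPullback A ω v = polySubst A (ω fun i => A.mulVec (v i)) := rfl

theorem formPullback_formPullback {n p : ℕ} (A B : Matrix (Fin n) (Fin n) ℂ)
    (ω : PolyForm n p) : formPullback B (formPullback A ω) = formPullback (A * B) ω := by
  ext1 v
  simp [formPullback_apply, polySubst_polySubst]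

theorem formPullback_one {n p : ℕ} (ω : PolyForm n p) : formPullback 1 ω = ω := by
  ext1 v
  have h : polySubst (1 : Matrix (Fin n) (Fin n) ℂ) = AlgHom.id ℂ _ := by
    ext1 i
    rw [polySubst_X, Finset.sum_eq_single i] <;> simp +contextual [eq_comm]
  simp [formPullback_apply, h]

/-- The `p`-forms on `ℂⁿ` whose coefficients are homogeneous of degree `m`. -/
def homForms (n p m : ℕ) : Submodule ℂ (PolyForm n p) where
  carrier := {ω | ∀ v, (ω v).IsHomogeneous m}
  zero_mem' := fun _ => MvPolynomial.isHomogeneous_zero _ _ _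
  add_mem' := fun ha hb v => (ha v).add (hb v)
  smul_mem' := fun c _ ha v => (MvPolynomial.homogeneousSubmodule (Fin n) ℂ m).smul_mem c (ha v)

theorem formPullback_mem_homForms {n p m : ℕ} (A : Matrix (Fin n) (Fin n) ℂ) {ω : PolyForm n p}
    (hω : ω ∈ homForms n p m) : formPullback A ω ∈ homForms n p m :=
  fun _ => polySubst_isHomogeneous A (hω _)

/-- The pull-back on forms with homogeneous coefficients. -/
def homPullback (n p m : ℕ) (A : Matrix (Fin n) (Fin n) ℂ) :
    Module.End ℂ (homForms n p m) :=
  (pullbackLin p A).restrict fun _ => formPullback_mem_homForms A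

theorem homPullback_coe {n p m : ℕ} (A : Matrix (Fin n) (Fin n) ℂ) (ω : homForms n p m) :
    (homPullback n p m A ω : PolyForm n p) = formPullback A ω := rfl

theorem homPullback_mul {n p m : ℕ} (A B : Matrix (Fin n) (Fin n) ℂ) :
    homPullback n p m (A * B) = homPullback n p m B * homPullback n p m A := by
  ext1 ω
  apply Subtype.ext
  simp [homPullback_coe, formPullback_formPullback]

theorem homPullback_one {n p m : ℕ} : homPullback n p m 1 = 1 := by
  ext1 ω
  apply Subtype.ext
  simp [homPullback_coe, formPullback_one]

theorem homPullback_scalar {n p m : ℕ} (c : ℂ) :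
    homPullback n p m (Matrix.scalar (Fin n) c) = c ^ (m + p) • 1 := by
  ext1 ω
  apply Subtype.ext
  ext1 v
  rw [homPullback_coe, formPullback_apply, polySubst_scalar c (ω.2 _)]
  have h : (fun i => (Matrix.scalar (Fin n) c).mulVec (v i)) = fun i => c • v i := by
    ext1 i
    rw [Matrix.scalar_apply, ← Matrix.smul_one_eq_diagonal, Matrix.smul_mulVec, Matrix.one_mulVec]
  rw [h, AlternatingMap.map_smul_univ (ω : PolyForm n p) (fun _ => c) v]
  simp [pow_add, smul_smul]

/-- The action `T · ω = (T⁻¹)^* ω` on forms with homogeneous coefficients. -/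
def formRep (n p m : ℕ) : GL (Fin n) ℂ →* Module.End ℂ (homForms n p m) where
  toFun T := homPullback n p m ((T⁻¹ : GL (Fin n) ℂ) : Matrix (Fin n) (Fin n) ℂ)
  map_one' := by rw [inv_one, Units.val_one, homPullback_one]
  map_mul' S T := by rw [mul_inv_rev, Units.val_mul, homPullback_mul]

/-! ### A basis of the forms with homogeneous coefficients -/

/-- A form is determined by its values on increasing sequences of basis vectors. -/
def coeffEquiv (n p : ℕ) :
    PolyForm n p ≃ₗ[ℂ] (Set.powersetCard (Fin n) p → MvPolynomial (Fin n) ℂ) :=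
  exteriorPower.alternatingMapLinearEquiv ≪≫ₗ
    (((Pi.basisFun ℂ (Fin n)).exteriorPower p).constr ℂ).symm

theorem coeffEquiv_apply {n p : ℕ} (ω : PolyForm n p) (s : Set.powersetCard (Fin n) p) :
    coeffEquiv n p ω s =
      ω (Pi.basisFun ℂ (Fin n) ∘ Set.powersetCard.ofFinEmbEquiv.symm s) := by
  simp [coeffEquiv, Module.Basis.constr, exteriorPower.ιMulti_family]

theorem mem_homForms_iff {n p m : ℕ} (ω : PolyForm n p) :
    ω ∈ homForms n p m ↔ ∀ s, (coeffEquiv n p ω s).IsHomogeneous m := by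
  refine ⟨fun h s => by rw [coeffEquiv_apply]; exact h _, fun h v => ?_⟩
  rw [← exteriorPower.alternatingMapLinearEquiv_apply_ιMulti,
    ← ((Pi.basisFun ℂ (Fin n)).exteriorPower p).sum_repr (exteriorPower.ιMulti ℂ p v), map_sum]
  refine MvPolynomial.IsHomogeneous.sum _ _ _ fun s _ => ?_
  rw [map_smul]
  refine (MvPolynomial.homogeneousSubmodule (Fin n) ℂ m).smul_mem _ ?_
  have := h s
  rw [coeffEquiv_apply] at this
  simpa [exteriorPower.ιMulti_family] using this

/-- Forms with homogeneous coefficients as families of homogeneous polynomials. -/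
def homCoeffEquiv (n p m : ℕ) : homForms n p m ≃ₗ[ℂ]
    (Set.powersetCard (Fin n) p →
      MvPolynomial.restrictSupport ℂ {d : Fin n →₀ ℕ | d.degree = m}) where
  toFun ω s := ⟨coeffEquiv n p ω s, by
    have := (mem_homForms_iff _).1 ω.2 s
    rwa [← MvPolynomial.mem_homogeneousSubmodule,
      MvPolynomial.homogeneousSubmodule_eq_finsupp_supported] at this⟩
  invFun f := ⟨(coeffEquiv n p).symm fun s => f s, (mem_homForms_iff _).2 fun s => by
    rw [LinearEquiv.apply_symm_apply, ← MvPolynomial.mem_homogeneousSubmodule,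
      MvPolynomial.homogeneousSubmodule_eq_finsupp_supported]
    exact (f s).2⟩
  left_inv ω := by simp
  right_inv f := by ext1 s; simp
  map_add' a b := by ext1 s; simp; rfl
  map_smul' c a := by ext1 s; simp; rfl

/-- The basis of monomial forms. -/
def homBasis (n p m : ℕ) : Module.Basis
    ((_ : Set.powersetCard (Fin n) p) × {d : Fin n →₀ ℕ | d.degree = m}) ℂ (homForms n p m) :=
  (Pi.basis fun _ => MvPolynomial.basisRestrictSupport ℂ _).map (homCoeffEquiv n p m).symm

instance (n m : ℕ) : Finite {d : Fin n →₀ ℕ | d.degree = m} :=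
  ((Finset.finsuppAntidiag Finset.univ m).finite_toSet.subset fun d hd => by
    simpa [Finset.mem_finsuppAntidiag, ← Finsupp.degree_eq_sum] using hd).to_subtype

instance (n p m : ℕ) : FiniteDimensional ℂ (homForms n p m) :=
  Module.Basis.finiteDimensional_of_finite (homBasis n p m)

theorem trace_eq_sum_of_basis_eigenvectors {ι V : Type*} [Fintype ι] [AddCommMonoid V] [Module ℂ V]
    (b : Module.Basis ι ℂ V) (f : Module.End ℂ V) (c : ι → ℂ) (h : ∀ i, f (b i) = c i • b i) :
    LinearMap.trace ℂ V f = ∑ i, c i := by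
  classical
  rw [LinearMap.trace_eq_matrix_trace ℂ b, Matrix.trace]
  simp [LinearMap.toMatrix_apply, h]

theorem basisRestrictSupport_coe {n : ℕ} (S : Set (Fin n →₀ ℕ)) (d : S) :
    (MvPolynomial.basisRestrictSupport ℂ S d : MvPolynomial (Fin n) ℂ) =
      MvPolynomial.monomial d.1 1 := by
  have h : MvPolynomial.monomial d.1 (1 : ℂ) ∈ MvPolynomial.restrictSupport ℂ S := by
    rw [MvPolynomial.restrictSupport_eq_span]
    exact Submodule.subset_span ⟨d.1, d.2, rfl⟩
  suffices MvPolynomial.basisRestrictSupport ℂ S d = ⟨_, h⟩ by rw [this]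
  rw [Module.Basis.apply_eq_iff]
  ext e
  change MvPolynomial.coeff e.1 (MvPolynomial.monomial d.1 (1 : ℂ)) = _
  rw [MvPolynomial.coeff_monomial, Finsupp.single_apply]
  simp only [Subtype.ext_iff]

theorem homCoeffEquiv_homBasis {n p m : ℕ} (t s : Set.powersetCard (Fin n) p)
    (d : {d : Fin n →₀ ℕ | d.degree = m}) :
    (homCoeffEquiv n p m (homBasis n p m ⟨t, d⟩) s : MvPolynomial (Fin n) ℂ) =
      if s = t then MvPolynomial.monomial d.1 1 else 0 := by
  rw [homBasis, Module.Basis.map_apply, LinearEquiv.apply_symm_apply, Pi.basis_apply,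
    Pi.single_apply]
  split_ifs with h
  · subst h
    exact basisRestrictSupport_coe _ d
  · rfl

theorem homCoeffEquiv_homPullback_diagonal {n p m : ℕ} (D : Fin n → ℂ) (ω : homForms n p m)
    (s : Set.powersetCard (Fin n) p) :
    (homCoeffEquiv n p m (homPullback n p m (Matrix.diagonal D) ω) s : MvPolynomial (Fin n) ℂ) =
      (∏ j ∈ s.1, D j) • polySubst (Matrix.diagonal D) (homCoeffEquiv n p m ω s) := by
  change coeffEquiv n p (formPullback (Matrix.diagonal D) ω) s =
    _ • polySubst (Matrix.diagonal D) (coeffEquiv n p ω s)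
  rw [coeffEquiv_apply, coeffEquiv_apply, formPullback_apply]
  have h : (fun j => (Matrix.diagonal D).mulVec
      ((Pi.basisFun ℂ (Fin n) ∘ Set.powersetCard.ofFinEmbEquiv.symm s) j)) = fun j =>
      D (Set.powersetCard.ofFinEmbEquiv.symm s j) •
        (Pi.basisFun ℂ (Fin n) ∘ Set.powersetCard.ofFinEmbEquiv.symm s) j := by
    ext1 j
    simp [← Pi.single_smul]
  rw [h, AlternatingMap.map_smul_univ, map_smul, Set.powersetCard.ofFinEmbEquiv_symm_apply]
  congr 1
  conv_rhs => rw [← Finset.map_orderEmbOfFin_univ s.1 s.2, Finset.prod_map]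
  rfl

/-- This is what the monomial forms are for: they diagonalize every diagonal substitution at once,
with one factor from the differentials and one from the monomial. -/
theorem homPullback_diagonal_homBasis {n p m : ℕ} (D : Fin n → ℂ)
    (i : (_ : Set.powersetCard (Fin n) p) × {d : Fin n →₀ ℕ | d.degree = m}) :
    homPullback n p m (Matrix.diagonal D) (homBasis n p m i) =
      ((∏ j ∈ i.1.1, D j) * ∏ j, D j ^ i.2.1 j) • homBasis n p m i := by
  apply (homCoeffEquiv n p m).injective
  ext1 s
  apply Subtype.ext
  obtain ⟨t, d⟩ := i
  rw [homCoeffEquiv_homPullback_diagonal, homCoeffEquiv_homBasis, map_smul, Pi.smul_apply,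
    Submodule.coe_smul, homCoeffEquiv_homBasis]
  split_ifs with h
  · subst h
    rw [polySubst_diagonal_monomial, smul_smul]
  · simp

/-- The trace of a diagonal matrix on the `p`-forms of degree `m`. -/
theorem trace_homPullback_diagonal {n p m : ℕ} (D : Fin n → ℂ) :
    LinearMap.trace ℂ _ (homPullback n p m (Matrix.diagonal D)) =
      (∑ s ∈ Finset.powersetCard p Finset.univ, ∏ j ∈ s, D j) *
        PowerSeries.coeff m (∏ j, PowerSeries.mk fun k => D j ^ k) := by
  classical
  have : Fintype {d : Fin n →₀ ℕ | d.degree = m} := Fintype.ofFinite _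
  have h := trace_eq_sum_of_basis_eigenvectors (homBasis n p m)
    (homPullback n p m (Matrix.diagonal D))
    (fun i => (∏ j ∈ i.1.1, D j) * ∏ j, D j ^ i.2.1 j) (homPullback_diagonal_homBasis D)
  have h1 := Finset.sum_subtype
    (F := inferInstanceAs (Fintype (Set.powersetCard (Fin n) p)))
    (p := (· ∈ Set.powersetCard (Fin n) p))
    (Finset.powersetCard p Finset.univ) (by simp [Finset.mem_powersetCard])
    fun s => ∏ j ∈ s, D j
  have h2 := Finset.sum_subtype (F := this) (p := (· ∈ {d : Fin n →₀ ℕ | d.degree = m}))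
    (Finset.finsuppAntidiag Finset.univ m)
    (by simp [Finset.mem_finsuppAntidiag, Finsupp.degree_eq_sum]) fun d => ∏ j, D j ^ d j
  simp only [PowerSeries.coeff_prod, PowerSeries.coeff_mk]
  rw [h, Fintype.sum_sigma, h1, h2, Finset.sum_mul_sum]

theorem trace_homPullback_conj {n p m : ℕ} (S A : Matrix (Fin n) (Fin n) ℂ)
    (hS : IsUnit S.det) :
    LinearMap.trace ℂ _ (homPullback n p m (S * A * S⁻¹)) =
      LinearMap.trace ℂ _ (homPullback n p m A) := by
  rw [homPullback_mul, LinearMap.trace_mul_comm, ← homPullback_mul,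
    Matrix.nonsing_inv_mul_cancel_left _ _ hS]

/-! ### Diagonalization of unitary matrices -/

/-- With `H = A + A*` and `K = i(A - A*)`, normality makes these Hermitian matrices commute, and `A
= (H - iK) / 2`. Joint eigenvectors of `H` and `K` span the space and are eigenvectors of `A`. -/
theorem span_eigenvectors_eq_top {n : ℕ} {A : Matrix (Fin n) (Fin n) ℂ}
    (hA : A * A.conjTranspose = A.conjTranspose * A) :
    ⊤ ≤ Submodule.span ℂ {v | ∃ c : ℂ, Matrix.toEuclideanLin A v = c • v} := by
  set H : Matrix (Fin n) (Fin n) ℂ := A + A.conjTranspose with hH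
  set K : Matrix (Fin n) (Fin n) ℂ := Complex.I • (A - A.conjTranspose) with hK
  have hHs : (Matrix.toEuclideanLin H).IsSymmetric :=
    Matrix.isSymmetric_toEuclideanLin_iff.2 (by simp [Matrix.IsHermitian, hH, add_comm])
  have hKs : (Matrix.toEuclideanLin K).IsSymmetric :=
    Matrix.isSymmetric_toEuclideanLin_iff.2 (by
      simp [Matrix.IsHermitian, hK, ← smul_neg])
  have hmul (B C : Matrix (Fin n) (Fin n) ℂ) : Matrix.toEuclideanLin (B * C) =
      Matrix.toEuclideanLin B * Matrix.toEuclideanLin C := by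
    ext v
    simp [Matrix.toLpLin_apply]
  have hc : Commute (Matrix.toEuclideanLin H) (Matrix.toEuclideanLin K) := by
    rw [Commute, SemiconjBy, ← hmul, ← hmul, hH, hK, Matrix.mul_smul, Matrix.smul_mul]
    congr 2
    noncomm_ring [hA]
  rw [← LinearMap.IsSymmetric.iSup_iSup_eigenspace_inf_eigenspace_eq_top_of_commute hHs hKs hc]
  refine iSup_le fun α => iSup_le fun β => fun v hv => Submodule.subset_span ?_
  obtain ⟨h1, h2⟩ := hv
  rw [SetLike.mem_coe, Module.End.mem_eigenspace_iff] at h1 h2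
  refine ⟨(1 / 2 : ℂ) * (α - Complex.I * β), ?_⟩
  have : A = (1 / 2 : ℂ) • (H - Complex.I • K) := by
    rw [hH, hK, smul_smul, Complex.I_mul_I]
    module
  rw [this, map_smul, map_sub, map_smul, LinearMap.smul_apply, LinearMap.sub_apply,
    LinearMap.smul_apply, h1, h2]
  module

/-- A basis is extracted from the spanning set of eigenvectors. An invertible `S` is enough, since
only traces are taken afterwards; it need not be unitary. -/
theorem exists_conj_diagonal_of_normal {n : ℕ} {A : Matrix (Fin n) (Fin n) ℂ}
    (hA : A * A.conjTranspose = A.conjTranspose * A) :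
    ∃ (S : Matrix (Fin n) (Fin n) ℂ) (D : Fin n → ℂ), IsUnit S.det ∧
      A = S * Matrix.diagonal D * S⁻¹ := by
  have hs := span_eigenvectors_eq_top hA
  let b₀ := Module.Basis.ofSpan hs
  have : Fintype ((linearIndepOn_empty ℂ (id : EuclideanSpace ℂ (Fin n) → _)).extend
      (Set.empty_subset {v | ∃ c : ℂ, Matrix.toEuclideanLin A v = c • v})) :=
    FiniteDimensional.fintypeBasisIndex b₀
  let e := Fintype.equivFinOfCardEq (by
    rw [← Module.finrank_eq_card_basis b₀, finrank_euclideanSpace_fin] : _ = n)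
  let b := b₀.reindex e
  have hb (j : Fin n) : ∃ c : ℂ, Matrix.toEuclideanLin A (b j) = c • b j := by
    have := Module.Basis.ofSpan_subset hs (Set.mem_range_self (e.symm j))
    simpa [b, b₀] using this
  choose D hD using hb
  let E := (EuclideanSpace.basisFun (Fin n) ℂ).toBasis
  refine ⟨E.toMatrix b, D, ?_, ?_⟩
  · rw [← Module.Basis.det_apply]
    exact E.isUnit_det b
  · have hu : IsUnit (E.toMatrix b).det := by
      rw [← Module.Basis.det_apply]
      exact E.isUnit_det b
    rw [← Matrix.mul_nonsing_inv_cancel_right _ A hu]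
    congr 1
    ext i j
    have := congrArg (fun v => v i) (hD j)
    rw [Matrix.mul_diagonal, Matrix.mul_apply]
    simpa [E, Module.Basis.toMatrix_apply, Matrix.toLpLin_apply, Matrix.mulVec, dotProduct,
      mul_comm] using this

/-! ### Characters of special unitary matrices -/

/-- The trace on `⋀^p ℂ³` of a special unitary matrix with trace `c`. -/
def extChar (p : ℕ) (c : ℂ) : ℂ :=
  match p with
  | 0 => 1
  | 1 => c
  | 2 => star c
  | 3 => 1
  | _ => 0

/-- `1 / det(1 - t A)` for a special unitary matrix `A` with trace `c`. -/
def symChar (c : ℂ) : PowerSeries ℂ :=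
  (1 - PowerSeries.C c * PowerSeries.X + PowerSeries.C (star c) * PowerSeries.X ^ 2 -
    PowerSeries.X ^ 3)⁻¹

theorem geometric_mul (a : ℂ) :
    PowerSeries.mk (fun k => a ^ k) * (1 - PowerSeries.C a * PowerSeries.X) = 1 := by
  have h : PowerSeries.mk (fun k => a ^ k) = 1 + PowerSeries.C a * PowerSeries.X *
      PowerSeries.mk (fun k => a ^ k) := by
    ext k
    cases k with
    | zero => simp [mul_assoc]
    | succ k =>
      rw [mul_assoc, map_add, PowerSeries.coeff_C_mul, PowerSeries.coeff_succ_X_mul]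
      simp [pow_succ', PowerSeries.coeff_one]
  linear_combination h

/-- The adjoint is the inverse, and since the eigenvalues multiply to 1, the inverse of each is the
product of the other two. -/
theorem star_trace_eq_of_diagonalized {A S : Matrix (Fin 3) (Fin 3) ℂ} {D : Fin 3 → ℂ}
    (hA : A ∈ Matrix.unitaryGroup (Fin 3) ℂ) (hS : IsUnit S.det)
    (h : A = S * Matrix.diagonal D * S⁻¹) (hD : D 0 * D 1 * D 2 = 1) :
    star A.trace = D 0 * D 1 + D 0 * D 2 + D 1 * D 2 := by
  have h1 : star A = S * Matrix.diagonal ![D 1 * D 2, D 0 * D 2, D 0 * D 1] * S⁻¹ := by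
    refine left_inv_eq_right_inv (Matrix.mem_unitaryGroup_iff'.1 hA) ?_
    have h2 : Matrix.diagonal D * Matrix.diagonal ![D 1 * D 2, D 0 * D 2, D 0 * D 1] = 1 := by
      rw [Matrix.diagonal_mul_diagonal, ← Matrix.diagonal_one]
      congr 1
      ext i
      fin_cases i <;> simp <;> linear_combination hD
    rw [h]
    calc S * Matrix.diagonal D * S⁻¹ *
        (S * Matrix.diagonal ![D 1 * D 2, D 0 * D 2, D 0 * D 1] * S⁻¹)
        = S * (Matrix.diagonal D * ((S⁻¹ * S) *
            Matrix.diagonal ![D 1 * D 2, D 0 * D 2, D 0 * D 1])) * S⁻¹ := by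
          simp only [Matrix.mul_assoc]
      _ = 1 := by rw [Matrix.nonsing_inv_mul S hS, Matrix.one_mul, h2, Matrix.mul_one,
          Matrix.mul_nonsing_inv S hS]
  rw [← Matrix.trace_conjTranspose, ← Matrix.star_eq_conjTranspose, h1, Matrix.trace_mul_cycle,
    Matrix.nonsing_inv_mul S hS, Matrix.one_mul, Matrix.trace_diagonal, Fin.sum_univ_three]
  simp
  ring

/-- The character of the forms of degree `m` on special unitary matrices. -/
theorem trace_homPullback_of_unitary {p m : ℕ} {A : Matrix (Fin 3) (Fin 3) ℂ}
    (hA : A ∈ Matrix.unitaryGroup (Fin 3) ℂ) (hdet : A.det = 1) :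
    LinearMap.trace ℂ _ (homPullback 3 p m A) =
      extChar p A.trace * PowerSeries.coeff m (symChar A.trace) := by
  have hN : A * A.conjTranspose = A.conjTranspose * A := by
    rw [← Matrix.star_eq_conjTranspose, Matrix.mem_unitaryGroup_iff'.1 hA]
    exact Matrix.mem_unitaryGroup_iff.1 hA
  obtain ⟨S, D, hS, h⟩ := exists_conj_diagonal_of_normal hN
  have htr : A.trace = D 0 + D 1 + D 2 := by
    rw [h, Matrix.trace_mul_cycle, Matrix.nonsing_inv_mul S hS, Matrix.one_mul,
      Matrix.trace_diagonal, Fin.sum_univ_three]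
  have hD : D 0 * D 1 * D 2 = 1 := by
    rw [← hdet, h, Matrix.det_conj ((Matrix.isUnit_iff_isUnit_det S).2 hS), Matrix.det_diagonal,
      Fin.prod_univ_three]
  have hst := star_trace_eq_of_diagonalized hA hS h hD
  have he : (∑ s ∈ Finset.powersetCard p (Finset.univ : Finset (Fin 3)), ∏ j ∈ s, D j) =
      extChar p A.trace := by
    match p with
    | 0 => simp [extChar]
    | 1 => simp [extChar, Finset.powersetCard_one, htr, Fin.sum_univ_three]
    | 2 =>
      have : Finset.powersetCard 2 (Finset.univ : Finset (Fin 3)) =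
        {{0, 1}, {0, 2}, {1, 2}} := by decide
      rw [this, extChar, hst]
      simp [Finset.sum_insert, show ({0, 1} : Finset (Fin 3)) ≠ {0, 2} by decide,
        show ({0, 1} : Finset (Fin 3)) ≠ {1, 2} by decide,
        show ({0, 2} : Finset (Fin 3)) ≠ {1, 2} by decide, add_assoc]
    | 3 =>
      have : Finset.powersetCard 3 (Finset.univ : Finset (Fin 3)) = {Finset.univ} := by decide
      rw [this, extChar, Finset.sum_singleton, Fin.prod_univ_three, hD]
    | k + 4 =>
      rw [Finset.powersetCard_eq_empty.2 (by simp)]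
      simp [extChar]
  -- The product of the three geometric series inverts `∏ (1 - D j t)`, whose coefficients are the
  -- elementary symmetric functions `c`, `star c`, `1` of the eigenvalues.
  have hs : (∏ j, PowerSeries.mk fun k => D j ^ k) = symChar A.trace := by
    rw [symChar, PowerSeries.eq_inv_iff_mul_eq_one (by simp), Fin.prod_univ_three, hst, htr]
    have h0 := geometric_mul (D 0)
    have h1 := geometric_mul (D 1)
    have h2 := geometric_mul (D 2)
    have h3 : (PowerSeries.C (D 0) * PowerSeries.C (D 1) * PowerSeries.C (D 2) : PowerSeries ℂ)
      = 1 := by rw [← map_mul, ← map_mul, hD, map_one]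
    set F := PowerSeries.mk fun k => D 0 ^ k
    set G := PowerSeries.mk fun k => D 1 ^ k
    set H := PowerSeries.mk fun k => D 2 ^ k
    simp only [map_add, map_mul]
    calc _ = (F * (1 - PowerSeries.C (D 0) * PowerSeries.X)) *
          (G * (1 - PowerSeries.C (D 1) * PowerSeries.X)) *
          (H * (1 - PowerSeries.C (D 2) * PowerSeries.X)) := by
          linear_combination F * G * H * PowerSeries.X ^ 3 * h3
      _ = 1 := by rw [h0, h1, h2, mul_one, mul_one]
  rw [h, trace_homPullback_conj S _ hS, trace_homPullback_diagonal, he, hs, ← h]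

/-! ### Projection onto the invariants -/

/-- In a group generated by `z, y, t, p, q` subject to the relations below, the sum of the `360`
elements, arranged as an icosahedral coset and a double coset. -/
theorem valentiner_group_algebra {E : Type*} [Ring E] [Algebra ℂ E] {z y t p q : E}
    (hzz : z * z = 1) (hyy : y * y = 1) (hzy : y * z = z * y) (htz : t * z = y * t)
    (hty : t * y = z * y * t) (htt : t * t * t = 1) (hp : p * p ^ 4 = 1)
    (hzp1 : z * p = p ^ 3 * (z * y * t ^ 2)) (hzp2 : z * p ^ 2 = p ^ 4 * (z * y * t))
    (hzp3 : z * p ^ 3 = p * (z * t)) (hzp4 : z * p ^ 4 = p ^ 2 * (y * t ^ 2))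
    (htp1 : t * p = p ^ 3 * (y * t)) (htp2 : t * p ^ 2 = p ^ 2 * (z * t ^ 2))
    (htp3 : t * p ^ 3 = p ^ 4 * y) (htp4 : t * p ^ 4 = p * t ^ 2)
    (hqq : q * q = z) (hzq : z * q = q * z) (htq : t * q = q * (z * y * t ^ 2))
    (hq1 : q * p * q = p ^ 2 * q * (p ^ 2 * (y * t)))
    (hq2 : q * p ^ 2 * q = p ^ 3 * q * (p * (z * t)))
    (hq3 : q * p ^ 3 * q = p ^ 4 * q * (p ^ 4 * (z * y * t ^ 2)))
    (hq4 : q * p ^ 4 * q = p * q * (p ^ 3 * (z * y * t ^ 2)))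
    (e A : E)
    (he : e = (1 + p + p ^ 2 + p ^ 3 + p ^ 4) * ((1 + z) * (1 + y) * (1 + t + t ^ 2)))
    (hA : A = e + (1 + p + p ^ 2 + p ^ 3 + p ^ 4) * (q * e)) :
    (z * A = A ∧ t * A = A ∧ p * A = A ∧ q * A = A) ∧ e * e = (60 : ℂ) • e ∧
      A = e + (1 / 12 : ℂ) • (e * (q * e)) := by
  set eT := (1 + z) * (1 + y) * (1 + t + t ^ 2) with heT
  set S := 1 + p + p ^ 2 + p ^ 3 + p ^ 4 with hS
  have hzT : z * eT = eT := by
    have : z * (1 + z) = 1 + z := by rw [mul_add, hzz, mul_one, add_comm]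
    rw [heT, mul_assoc, ← mul_assoc z, this]
  have hyT : y * eT = eT := by
    have h1 : y * (1 + z) = (1 + z) * y := by rw [mul_add, add_mul, hzy, mul_one, one_mul]
    have h2 : y * (1 + y) = 1 + y := by rw [mul_add, hyy, mul_one, add_comm]
    rw [heT, mul_assoc, ← mul_assoc y, h1, mul_assoc (1 + z), ← mul_assoc y, h2]
  have htT : t * eT = eT := by
    have h1 : t * ((1 + z) * (1 + y)) = (1 + z) * (1 + y) * t := by
      have : t * (z * y) = z * t := by
        rw [← mul_assoc, htz, mul_assoc, hty, ← mul_assoc, ← mul_assoc, hzy, mul_assoc z, hyy,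
          mul_one]
      calc t * ((1 + z) * (1 + y)) = t + t * z + t * y + t * (z * y) := by noncomm_ring
        _ = t + y * t + z * y * t + z * t := by rw [htz, hty, this]
        _ = _ := by noncomm_ring
    have h2 : t * (1 + t + t ^ 2) = 1 + t + t ^ 2 := by
      have : t * t ^ 2 = 1 := by rw [pow_two, ← mul_assoc, htt]
      rw [mul_add, mul_add, this, mul_one, ← pow_two]
      abel
    rw [heT, ← mul_assoc, h1, mul_assoc, h2]
  have hpS : p * S = S := by
    have : p * S = p + p ^ 2 + p ^ 3 + p ^ 4 + p * p ^ 4 := by rw [hS]; noncomm_ring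
    rw [this, hp, hS]
    abel
  -- The relations move `z` and `t` past powers of `p` at the cost of a tetrahedral factor, so both
  -- permute the five translates `p ^ a * x` of any tetrahedrally fixed `x`. This is used for `x =
  -- eT` and for `x = q * e`.
  have tet {x : E} (hzx : z * x = x) (hyx : y * x = x) (htx : t * x = x) :
      S * x = x + p * x + p ^ 2 * x + p ^ 3 * x + p ^ 4 * x ∧
      z * (S * x) = S * x ∧ t * (S * x) = S * x := by
    have ht2 : t ^ 2 * x = x := by rw [pow_two, mul_assoc, htx, htx]
    have h0 : S * x = x + p * x + p ^ 2 * x + p ^ 3 * x + p ^ 4 * x := by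
      rw [hS]; simp only [add_mul, one_mul]
    refine ⟨h0, ?_, ?_⟩
    · rw [h0]
      simp only [mul_add, ← mul_assoc, hzp1, hzp2, hzp3, hzp4]
      simp only [mul_assoc, hzx, hyx, htx, ht2]
      abel
    · rw [h0]
      simp only [mul_add, ← mul_assoc, htp1, htp2, htp3, htp4]
      simp only [mul_assoc, hzx, hyx, htx, ht2]
      abel
  have hz : z * e = e := by rw [he]; exact (tet hzT hyT htT).2.1
  have ht : t * e = e := by rw [he]; exact (tet hzT hyT htT).2.2
  have hyt {x : E} (h1 : z * x = x) (h2 : t * x = x) : y * x = x := by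
    have : y = t * z * t ^ 2 := by rw [htz, pow_two, mul_assoc, ← mul_assoc t, htt, mul_one]
    rw [this, pow_two, mul_assoc, mul_assoc, mul_assoc, h2, h2, h1, h2]
  have hy : y * e = e := hyt hz ht
  have hpe : p * e = e := by rw [he, ← mul_assoc, hpS]
  have ht2 : t ^ 2 * e = e := by rw [pow_two, mul_assoc, ht, ht]
  have hp2 : p ^ 2 * e = e := by rw [pow_two, mul_assoc, hpe, hpe]
  have hp3 : p ^ 3 * e = e := by rw [pow_succ, mul_assoc, hpe, hp2]
  have hp4 : p ^ 4 * e = e := by rw [pow_succ, mul_assoc, hpe, hp3]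
  -- Conjugation by `q` preserves the tetrahedral group, so `q * e` is still fixed by it.
  have hzqe : z * (q * e) = q * e := by rw [← mul_assoc, hzq, mul_assoc, hz]
  have htqe : t * (q * e) = q * e := by
    rw [← mul_assoc, htq]
    simp only [mul_assoc, ht2, hy, hz]
  have hyqe : y * (q * e) = q * e := hyt hzqe htqe
  obtain ⟨h0, h1, h2⟩ := tet hzqe hyqe htqe
  have twelve {x : E} (hzx : z * x = x) (hyx : y * x = x) (htx : t * x = x) :
      e * x = (12 : ℂ) • (S * x) := by
    have ht2 : t ^ 2 * x = x := by rw [pow_two, mul_assoc, htx, htx]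
    have : eT * x = (12 : ℂ) • x := by
      rw [heT]
      simp only [mul_assoc, add_mul, mul_add, one_mul, hzx, hyx, htx, ht2]
      module
    rw [he, mul_assoc, this, mul_smul_comm]
  refine ⟨⟨?_, ?_, ?_, ?_⟩, ?_, ?_⟩
  · rw [hA, mul_add, hz, h1]
  · rw [hA, mul_add, ht, h2]
  · rw [hA, mul_add, hpe, ← mul_assoc, hpS]
  -- Left multiplication by `q` exchanges `e` and `q * e`, and sends `p ^ a * q * e` to `p ^ b * q *
  -- e` with `a ↦ b` the cycle 1, 2, 3, 4.
  · rw [hA, h0, mul_add, mul_add, mul_add, mul_add, mul_add]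
    simp only [← mul_assoc, hqq, hq1, hq2, hq3, hq4]
    simp only [mul_assoc, hz, hy, ht, ht2, hpe, hp2, hp3, hp4]
    abel
  · rw [twelve hz hy ht, hS]
    simp only [add_mul, one_mul, hpe, hp2, hp3, hp4]
    module
  · rw [twelve hzqe hyqe htqe, hA, smul_smul]
    norm_num

/-- An operator that fixes the vectors fixed by a family of operators and takes values in them
has the dimension of that space as trace. -/
theorem trace_eq_finrank_of_projection {V : Type*} [AddCommGroup V] [Module ℂ V]
    [FiniteDimensional ℂ V] (W : Submodule ℂ V) (A : Module.End ℂ V) (h1 : ∀ v, A v ∈ W)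
    (h2 : ∀ v ∈ W, A v = v) : LinearMap.trace ℂ V A = Module.finrank ℂ W :=
  LinearMap.IsProj.trace ⟨h1, h2⟩

/-! ### Relations between the generators -/

theorem rho_sq : rho ^ 2 = -1 - rho := by
  have h : rho ≠ 1 := by
    have := Complex.isPrimitiveRoot_exp 3 (by norm_num)
    exact this.ne_one (by norm_num)
  have h3 := rho_pow_three
  have : (rho - 1) * (rho ^ 2 + rho + 1) = 0 := by linear_combination h3
  rcases mul_eq_zero.1 this with h0 | h0
  · exact absurd (sub_eq_zero.1 h0) h
  · linear_combination h0

theorem tau_inv : tau⁻¹ = tau - 1 := by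
  have h := tau_sq
  have h0 := tau_ne_zero
  field_simp
  linear_combination -h

theorem matP_eq : matP = !![1 / 2, (tau - 1) / 2, -tau / 2; (tau - 1) / 2, tau / 2, 1 / 2;
    tau / 2, -1 / 2, (tau - 1) / 2] := by
  rw [matP, tau_inv]

theorem matP_sq : matP ^ 2 = !![(1 - tau) / 2, tau / 2, -1 / 2; tau / 2, 1 / 2, (tau - 1) / 2;
    1 / 2, (1 - tau) / 2, -tau / 2] := by
  have h := tau_sq
  rw [pow_two, matP_eq]
  ext i j
  fin_cases i <;> fin_cases j <;> simp [Matrix.mul_apply, Fin.sum_univ_three] <;> grind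

theorem matP_pow_three : matP ^ 3 = !![(1 - tau) / 2, tau / 2, 1 / 2;
    tau / 2, 1 / 2, (1 - tau) / 2; -1 / 2, (tau - 1) / 2, -tau / 2] := by
  have h := tau_sq
  rw [pow_succ, matP_sq, matP_eq]
  ext i j
  fin_cases i <;> fin_cases j <;> simp [Matrix.mul_apply, Fin.sum_univ_three] <;> grind

theorem matP_pow_four : matP ^ 4 = !![1 / 2, (tau - 1) / 2, tau / 2;
    (tau - 1) / 2, tau / 2, -1 / 2; -tau / 2, 1 / 2, (tau - 1) / 2] := by
  have h := tau_sq
  rw [pow_succ, matP_pow_three, matP_eq]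
  ext i j
  fin_cases i <;> fin_cases j <;> simp [Matrix.mul_apply, Fin.sum_univ_three] <;> grind

theorem matT_sq : matT ^ 2 = !![0, 1, 0; 0, 0, 1; 1, 0, 0] := by
  rw [pow_two, matT]
  ext i j
  fin_cases i <;> fin_cases j <;> simp [Matrix.mul_apply, Fin.sum_univ_three]

/-- The involution conjugate to `Z₁` under `T₁`. -/
def matY : Matrix (Fin 3) (Fin 3) ℂ := !![-1, 0, 0; 0, 1, 0; 0, 0, -1]

theorem det_matY : matY.det = 1 := by
  simp [matY, Matrix.det_fin_three]

theorem det_scalar_rho : (Matrix.scalar (Fin 3) rho).det = 1 := by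
  simp [rho_pow_three]

theorem coe_toGL {A : Matrix (Fin 3) (Fin 3) ℂ} (hA : A.det = 1) :
    (toGL A hA : Matrix (Fin 3) (Fin 3) ℂ) = A := rfl

theorem matZ_mul_matZ : matZ * matZ = 1 := by
  rw [matZ]
  ext i j
  fin_cases i <;> fin_cases j <;> simp [Matrix.mul_apply, Fin.sum_univ_three]

theorem matY_mul_matY : matY * matY = 1 := by
  rw [matY]
  ext i j
  fin_cases i <;> fin_cases j <;> simp [Matrix.mul_apply, Fin.sum_univ_three]

theorem matY_mul_matZ : matY * matZ = matZ * matY := by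
  rw [matY, matZ]
  ext i j
  fin_cases i <;> fin_cases j <;> simp [Matrix.mul_apply, Fin.sum_univ_three]

theorem matT_mul_matZ : matT * matZ = matY * matT := by
  rw [matY, matZ, matT]
  ext i j
  fin_cases i <;> fin_cases j <;> simp [Matrix.mul_apply, Fin.sum_univ_three]

theorem matT_mul_matY : matT * matY = matZ * matY * matT := by
  rw [matY, matZ, matT]
  ext i j
  fin_cases i <;> fin_cases j <;> simp [Matrix.mul_apply, Fin.sum_univ_three]

theorem matT_mul_matT : matT * matT * matT = 1 := by
  rw [matT]
  ext i j
  fin_cases i <;> fin_cases j <;> simp [Matrix.mul_apply, Fin.sum_univ_three]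

theorem matP_mul_pow_four : matP * matP ^ 4 = 1 := by
  have h := tau_sq
  rw [matP_pow_four, matP_eq]
  ext i j
  fin_cases i <;> fin_cases j <;> simp [Matrix.mul_apply, Fin.sum_univ_three] <;> grind

/-- This and the next seven identities give the action of `Z₁` and `T₁` on the five cosets of the
tetrahedral group in the icosahedral group. -/
theorem matZ_mul_matP : matZ * matP = matP ^ 3 * (matZ * matY * matT ^ 2) := by
  rw [matP_pow_three, matP_eq, matT_sq, matZ, matY]
  ext i j
  fin_cases i <;> fin_cases j <;> simp [Matrix.mul_apply, Fin.sum_univ_three] <;> ring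

theorem matZ_mul_matP_sq : matZ * matP ^ 2 = matP ^ 4 * (matZ * matY * matT) := by
  rw [matP_pow_four, matP_sq, matT, matZ, matY]
  ext i j
  fin_cases i <;> fin_cases j <;> simp [Matrix.mul_apply, Fin.sum_univ_three] <;> ring

theorem matZ_mul_matP_pow_three : matZ * matP ^ 3 = matP * (matZ * matT) := by
  rw [matP_pow_three, matP_eq, matT, matZ]
  ext i j
  fin_cases i <;> fin_cases j <;> simp [Matrix.mul_apply, Fin.sum_univ_three] <;> ring

theorem matZ_mul_matP_pow_four : matZ * matP ^ 4 = matP ^ 2 * (matY * matT ^ 2) := by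
  rw [matP_pow_four, matP_sq, matT_sq, matZ, matY]
  ext i j
  fin_cases i <;> fin_cases j <;> simp [Matrix.mul_apply, Fin.sum_univ_three] <;> ring

theorem matT_mul_matP : matT * matP = matP ^ 3 * (matY * matT) := by
  rw [matP_pow_three, matP_eq, matT, matY]
  ext i j
  fin_cases i <;> fin_cases j <;> simp [Matrix.mul_apply, Fin.sum_univ_three] <;> ring

theorem matT_mul_matP_sq : matT * matP ^ 2 = matP ^ 2 * (matZ * matT ^ 2) := by
  rw [matP_sq, matT_sq, matT, matZ]
  ext i j
  fin_cases i <;> fin_cases j <;> simp [Matrix.mul_apply, Fin.sum_univ_three] <;> ring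

theorem matT_mul_matP_pow_three : matT * matP ^ 3 = matP ^ 4 * matY := by
  rw [matP_pow_three, matP_pow_four, matT, matY]
  ext i j
  fin_cases i <;> fin_cases j <;> simp [Matrix.mul_apply, Fin.sum_univ_three] <;> ring

theorem matT_mul_matP_pow_four : matT * matP ^ 4 = matP * matT ^ 2 := by
  rw [matP_pow_four, matP_eq, matT_sq, matT]
  ext i j
  fin_cases i <;> fin_cases j <;> simp [Matrix.mul_apply, Fin.sum_univ_three]

theorem matQ_mul_matQ : matQ * matQ = matZ := by
  have h := rho_pow_three
  rw [matQ, matZ]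
  ext i j
  fin_cases i <;> fin_cases j <;> simp [Matrix.mul_apply, Fin.sum_univ_three] <;> grind

theorem matZ_mul_matQ : matZ * matQ = matQ * matZ := by
  rw [matQ, matZ]
  ext i j
  fin_cases i <;> fin_cases j <;> simp [Matrix.mul_apply, Fin.sum_univ_three]

/-- Some relations involving `Q` hold in `SU₃` only up to a power of the central scalar `ρ`, which
disappears in the representations with `3 ∣ m + p`. -/
theorem matT_mul_matQ :
    matT * matQ = matQ * (matZ * matY * matT ^ 2) * Matrix.scalar (Fin 3) rho := by
  have h := rho_sq
  rw [matQ, matZ, matY, matT_sq, matT]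
  ext i j
  fin_cases i <;> fin_cases j <;> simp [Matrix.mul_apply, Fin.sum_univ_three] <;> grind

theorem matQ_mul_matP_mul_matQ : matQ * matP * matQ =
    matP ^ 2 * matQ * (matP ^ 2 * (matY * matT)) * Matrix.scalar (Fin 3) rho ^ 2 := by
  have h := rho_sq
  have h' := tau_sq
  rw [matP_sq, matP_eq, matQ, matY, matT, ← map_pow]
  ext i j
  fin_cases i <;> fin_cases j <;> simp [Matrix.mul_apply, Fin.sum_univ_three] <;> grind

theorem matQ_mul_matP_sq_mul_matQ : matQ * matP ^ 2 * matQ =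
    matP ^ 3 * matQ * (matP * (matZ * matT)) := by
  have h := rho_sq
  have h' := tau_sq
  rw [matP_pow_three, matP_sq, matP_eq, matQ, matZ, matT]
  ext i j
  fin_cases i <;> fin_cases j <;> simp [Matrix.mul_apply, Fin.sum_univ_three] <;> grind

theorem matQ_mul_matP_pow_three_mul_matQ : matQ * matP ^ 3 * matQ =
    matP ^ 4 * matQ * (matP ^ 4 * (matZ * matY * matT ^ 2)) * Matrix.scalar (Fin 3) rho := by
  have h := rho_sq
  have h' := tau_sq
  rw [matP_pow_three, matP_pow_four, matQ, matZ, matY, matT_sq]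
  ext i j
  fin_cases i <;> fin_cases j <;> simp [Matrix.mul_apply, Fin.sum_univ_three] <;> grind

theorem matQ_mul_matP_pow_four_mul_matQ : matQ * matP ^ 4 * matQ =
    matP * matQ * (matP ^ 3 * (matZ * matY * matT ^ 2)) := by
  have h := rho_sq
  have h' := tau_sq
  rw [matP_pow_three, matP_pow_four, matP_eq, matQ, matZ, matY, matT_sq]
  ext i j
  fin_cases i <;> fin_cases j <;> simp [Matrix.mul_apply, Fin.sum_univ_three] <;> grind

/-! ### Sums of characters -/

theorem star_tau : (starRingEnd ℂ) tau = tau := Complex.conj_ofReal _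

theorem star_rho : (starRingEnd ℂ) rho = rho ^ 2 := by
  have h : (starRingEnd ℂ) rho * rho = 1 := by
    rw [rho, ← Complex.exp_conj, ← Complex.exp_add]
    simp [Complex.conj_ofReal, map_ofNat]
    ring_nf
    exact Complex.exp_zero
  linear_combination rho ^ 2 * h - (starRingEnd ℂ) rho * rho_pow_three

theorem matZ_mem_unitaryGroup : matZ ∈ Matrix.unitaryGroup (Fin 3) ℂ := by
  rw [Matrix.mem_unitaryGroup_iff, Matrix.star_eq_conjTranspose, matZ]
  ext i j
  fin_cases i <;> fin_cases j <;> simp [Matrix.mul_apply, Fin.sum_univ_three]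

theorem matY_mem_unitaryGroup : matY ∈ Matrix.unitaryGroup (Fin 3) ℂ := by
  rw [Matrix.mem_unitaryGroup_iff, Matrix.star_eq_conjTranspose, matY]
  ext i j
  fin_cases i <;> fin_cases j <;> simp [Matrix.mul_apply, Fin.sum_univ_three]

theorem matT_mem_unitaryGroup : matT ∈ Matrix.unitaryGroup (Fin 3) ℂ := by
  rw [Matrix.mem_unitaryGroup_iff, Matrix.star_eq_conjTranspose, matT]
  ext i j
  fin_cases i <;> fin_cases j <;> simp [Matrix.mul_apply, Fin.sum_univ_three]

theorem matP_mem_unitaryGroup : matP ∈ Matrix.unitaryGroup (Fin 3) ℂ := by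
  have h := tau_sq
  rw [Matrix.mem_unitaryGroup_iff, Matrix.star_eq_conjTranspose, matP_eq]
  ext i j
  fin_cases i <;> fin_cases j <;> simp [Matrix.mul_apply, Fin.sum_univ_three, star_tau,
    map_ofNat] <;> grind

theorem matQ_mem_unitaryGroup : matQ ∈ Matrix.unitaryGroup (Fin 3) ℂ := by
  have h := rho_pow_three
  rw [Matrix.mem_unitaryGroup_iff, Matrix.star_eq_conjTranspose, matQ]
  ext i j
  fin_cases i <;> fin_cases j <;> simp [Matrix.mul_apply, Fin.sum_univ_three, star_rho] <;> grind

theorem scalar_rho_mem_unitaryGroup :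
    Matrix.scalar (Fin 3) rho ∈ Matrix.unitaryGroup (Fin 3) ℂ := by
  have h := rho_pow_three
  rw [Matrix.mem_unitaryGroup_iff, Matrix.star_eq_conjTranspose]
  ext i j
  fin_cases i <;> fin_cases j <;> simp [star_rho] <;> grind

/-- Here `unitaryLift ⊤ ⊥` is all of `SU₃`, where the character formula applies. -/
theorem toGL_mem_unitaryLift {A : Matrix (Fin 3) (Fin 3) ℂ} (h : A.det = 1)
    (hA : A ∈ Matrix.unitaryGroup (Fin 3) ℂ) : toGL A h ∈ unitaryLift ⊤ ⊥ :=
  ⟨hA, Subgroup.mem_bot.2 (Units.ext h), Subgroup.mem_top _⟩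

/-- The character of `p`-forms of degree `m` at a special unitary matrix whose inverse has
trace `c`. -/
def formChar (p m : ℕ) (c : ℂ) : ℂ :=
  extChar p c * PowerSeries.coeff m (symChar c)

/-- Replacing `A` by `ρ A` in `det(1 - t A)` is the substitution `t ↦ ρ t`. -/
theorem symChar_rho_mul (c : ℂ) : symChar (rho * c) = PowerSeries.rescale rho (symChar c) := by
  rw [symChar, PowerSeries.inv_eq_iff_mul_eq_one (by simp)]
  have h : symChar c * (1 - PowerSeries.C c * PowerSeries.X +
      PowerSeries.C (star c) * PowerSeries.X ^ 2 - PowerSeries.X ^ 3) = 1 :=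
    PowerSeries.inv_mul_cancel _ (by simp)
  have h2 := congrArg (PowerSeries.rescale rho) h
  rw [map_mul, map_one] at h2
  have hC (a : ℂ) : PowerSeries.rescale rho (PowerSeries.C a) = PowerSeries.C a := by
    ext k
    cases k <;> simp [PowerSeries.coeff_C]
  have h3 : (PowerSeries.C rho : PowerSeries ℂ) ^ 3 = 1 := by
    rw [← map_pow, rho_pow_three, map_one]
  simp only [map_sub, map_add, map_mul, map_pow, map_one, PowerSeries.rescale_X, hC, star_mul',
    Complex.star_def, star_rho] at h2 ⊢
  linear_combination h2 + PowerSeries.rescale rho (symChar c) * PowerSeries.X ^ 3 * h3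

theorem extChar_rho_mul (p : ℕ) (c : ℂ) : extChar p (rho * c) = rho ^ p * extChar p c := by
  match p with
  | 0 => simp [extChar]
  | 1 => simp [extChar]
  | 2 => simp [extChar, star_rho]
  | 3 => simp [extChar, rho_pow_three]
  | k + 4 => simp [extChar]

theorem rho_pow_eq_one {k : ℕ} (h : 3 ∣ k) : rho ^ k = 1 := by
  obtain ⟨l, rfl⟩ := h
  rw [pow_mul, rho_pow_three, one_pow]

theorem formChar_rho_mul {p m : ℕ} (h : 3 ∣ m + p) (c : ℂ) :
    formChar p m (rho * c) = formChar p m c := by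
  rw [formChar, formChar, symChar_rho_mul, extChar_rho_mul, PowerSeries.coeff_rescale]
  have := rho_pow_eq_one h
  rw [pow_add] at this
  linear_combination extChar p c * PowerSeries.coeff m (symChar c) * this

theorem formChar_rho_pow_mul {p m : ℕ} (h : 3 ∣ m + p) (k : ℕ) (c : ℂ) :
    formChar p m (rho ^ k * c) = formChar p m c := by
  induction k with
  | zero => simp
  | succ k ih => rw [pow_succ', mul_assoc, formChar_rho_mul h, ih]

/-- The action pulls back along `g⁻¹`, whose trace is the conjugate `ρ ^ (2 * k) * v`; the power of
`ρ` does not affect the character. -/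
theorem trace_formRep {p m : ℕ} (h : 3 ∣ m + p) {g : GL (Fin 3) ℂ} (hg : g ∈ unitaryLift ⊤ ⊥)
    (k : ℕ) (v : ℝ) (htr : (g : Matrix (Fin 3) (Fin 3) ℂ).trace = rho ^ k * v) :
    LinearMap.trace ℂ _ (formRep 3 p m g) = formChar p m v := by
  have hi := inv_mem hg
  have hdet : ((g⁻¹ : GL (Fin 3) ℂ) : Matrix (Fin 3) (Fin 3) ℂ).det = 1 :=
    congrArg Units.val (Subgroup.mem_bot.1 hi.2.1)
  have hstar : ((g⁻¹ : GL (Fin 3) ℂ) : Matrix (Fin 3) (Fin 3) ℂ) = star (g : Matrix _ _ ℂ) :=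
    Units.inv_eq_of_mul_eq_one_left (Unitary.star_mul_self_of_mem hg.1)
  have h1 := trace_homPullback_of_unitary (p := p) (m := m) hi.1 hdet
  have h2 : ((g⁻¹ : GL (Fin 3) ℂ) : Matrix (Fin 3) (Fin 3) ℂ).trace = rho ^ (2 * k) * v := by
    rw [hstar, Matrix.star_eq_conjTranspose, Matrix.trace_conjTranspose, htr, star_mul',
      Complex.star_def, map_pow, star_rho, Complex.conj_ofReal, pow_mul]
  rw [h2] at h1
  exact h1.trans (formChar_rho_pow_mul h _ _)

/-- The character at a special unitary matrix with real trace. -/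
def realChar (p m : ℕ) (x : ℝ) : ℂ := formChar p m x

/-- The diagonal entries of the four sign matrices of determinant one. -/
def signs : Fin 4 → Fin 3 → ℂ := ![![1, 1, 1], ![1, -1, -1], ![-1, 1, -1], ![-1, -1, 1]]

/-- The three cyclic diagonals of a `3 × 3` matrix. -/
def cyclicDiag (M : Matrix (Fin 3) (Fin 3) ℂ) : Fin 3 → Fin 3 → ℂ :=
  ![![M 0 0, M 1 1, M 2 2], ![M 2 0, M 0 1, M 1 2], ![M 1 0, M 2 1, M 0 2]]

/-- The sum over the tetrahedral group. -/
def tetrahedralSum {V : Type*} [AddCommMonoid V] [Module ℂ V]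
    (R : GL (Fin 3) ℂ →* Module.End ℂ V) : Module.End ℂ V :=
  (1 + R (toGL matZ det_matZ)) * (1 + R (toGL matY det_matY)) *
    (1 + R (toGL matT det_matT) + R (toGL matT det_matT) ^ 2)

/-- The sum of the characters over a coset of the tetrahedral group. -/
theorem trace_mul_tetrahedral_sum {p m : ℕ} (h : 3 ∣ m + p) {g : GL (Fin 3) ℂ}
    (hg : g ∈ unitaryLift ⊤ ⊥) {M : Matrix (Fin 3) (Fin 3) ℂ}
    (hM : (g : Matrix (Fin 3) (Fin 3) ℂ) = M) (k : Fin 3 → Fin 4 → ℕ) (v : Fin 3 → Fin 4 → ℝ)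
    (hv : ∀ c s, ∑ j, signs s j * cyclicDiag M c j = rho ^ k c s * v c s) :
    LinearMap.trace ℂ _ (formRep 3 p m g * tetrahedralSum (formRep 3 p m)) =
      ∑ c, ∑ s, realChar p m (v c s) := by
  have hZ := toGL_mem_unitaryLift det_matZ matZ_mem_unitaryGroup
  have hY := toGL_mem_unitaryLift det_matY matY_mem_unitaryGroup
  have hT := toGL_mem_unitaryLift det_matT matT_mem_unitaryGroup
  let G : Fin 4 → GL (Fin 3) ℂ := ![1, toGL matZ det_matZ, toGL matY det_matY,
    toGL matZ det_matZ * toGL matY det_matY]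
  have hG (s) : G s ∈ unitaryLift ⊤ ⊥ := by
    fin_cases s
    exacts [one_mem _, hZ, hY, mul_mem hZ hY]
  have hGd (s) : (G s : Matrix (Fin 3) (Fin 3) ℂ) = Matrix.diagonal (signs s) := by
    ext i j
    fin_cases s <;> fin_cases i <;> fin_cases j <;>
      simp [G, signs, coe_toGL, matZ, matY, Matrix.mul_apply, Fin.sum_univ_three]
  -- Each tetrahedral element is a sign matrix times a power of `T₁`, so its product with `M` has as
  -- trace a signed sum along one cyclic diagonal of `M`.
  have hsum : formRep 3 p m g * tetrahedralSum (formRep 3 p m) =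
      ∑ c : Fin 3, ∑ s, formRep 3 p m (g * (G s * toGL matT det_matT ^ (c : ℕ))) := by
    simp only [Fin.sum_univ_three, Fin.sum_univ_four, map_mul, map_pow,
      tetrahedralSum]
    simp [G]
    noncomm_ring
  rw [hsum, map_sum]
  refine Finset.sum_congr rfl fun c _ => ?_
  rw [map_sum]
  refine Finset.sum_congr rfl fun s _ => ?_
  refine trace_formRep h (mul_mem hg (mul_mem (hG s) (pow_mem hT _))) (k c s) _ ?_
  rw [← hv c s, Units.val_mul, Units.val_mul, hM, hGd, Units.val_pow_eq_pow_val, coe_toGL]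
  fin_cases c
  · simp [Matrix.trace, cyclicDiag, Fin.sum_univ_three, mul_comm]
  · simp [Matrix.trace, cyclicDiag, matT, Matrix.mul_apply, Fin.sum_univ_three,
      Matrix.diagonal_apply, mul_comm]
    ring
  · simp [Matrix.trace, cyclicDiag, matT_sq, Matrix.mul_apply, Fin.sum_univ_three,
      Matrix.diagonal_apply, mul_comm]
    ring

/-- The golden ratio as a real number. -/
def tauReal : ℝ := Real.goldenRatio

/-- The conjugate `1 - τ` of the golden ratio as a real number. -/
def tauConj : ℝ := 1 - Real.goldenRatio

theorem coe_tauReal : (tauReal : ℂ) = tau := rfl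

theorem coe_tauConj : (tauConj : ℂ) = 1 - tau := by
  rw [tauConj, tau, Complex.ofReal_sub, Complex.ofReal_one]

/-- In this and the following coset sums, rows of the tables are the cyclic diagonals and columns
the sign patterns; the first table holds the exponent of `ρ`, the second the real factor of the
trace. -/
theorem trace_tetrahedral_sum {p m : ℕ} (h : 3 ∣ m + p) :
    LinearMap.trace ℂ _ (formRep 3 p m 1 *
      tetrahedralSum (formRep 3 p m)) =
      realChar p m 3 + 3 * realChar p m (-1) + 8 * realChar p m 0 := by
  have hM : ((1 : GL (Fin 3) ℂ) : Matrix (Fin 3) (Fin 3) ℂ) = 1 := rfl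
  rw [trace_mul_tetrahedral_sum h (one_mem _) hM (fun _ _ => 0)
    ![![3, -1, -1, -1], ![0, 0, 0, 0], ![0, 0, 0, 0]] ?_]
  · simp [Fin.sum_univ_three, Fin.sum_univ_four]
    ring
  · intro c s
    fin_cases c <;> fin_cases s <;> simp [signs, cyclicDiag, Fin.sum_univ_three]
    norm_num

theorem trace_P_tetrahedral_sum {p m : ℕ} (h : 3 ∣ m + p) :
    LinearMap.trace ℂ _ (formRep 3 p m (toGL matP det_matP) *
      tetrahedralSum (formRep 3 p m)) =
      3 * realChar p m (-1) + 3 * realChar p m 0 + 3 * realChar p m tauReal +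
        3 * realChar p m tauConj := by
  have hP := toGL_mem_unitaryLift det_matP matP_mem_unitaryGroup
  have hM : ((toGL matP det_matP : GL (Fin 3) ℂ) : Matrix (Fin 3) (Fin 3) ℂ) = _ :=
    matP_eq
  rw [trace_mul_tetrahedral_sum h hP hM (fun _ _ => 0)
    ![![tauReal, tauConj, 0, -1], ![tauReal, 0, -1, tauConj], ![-1, tauReal, 0, tauConj]] ?_]
  · simp [Fin.sum_univ_three, Fin.sum_univ_four]
    ring
  · have h1 := rho_sq
    have h3 := tau_sq
    intro c s
    fin_cases c <;> fin_cases s <;>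
      simp [signs, cyclicDiag, Fin.sum_univ_three, coe_tauConj, coe_tauReal] <;> grind

theorem trace_P_sq_tetrahedral_sum {p m : ℕ} (h : 3 ∣ m + p) :
    LinearMap.trace ℂ _ (formRep 3 p m (toGL matP det_matP ^ 2) *
      tetrahedralSum (formRep 3 p m)) =
      3 * realChar p m (-1) + 3 * realChar p m 0 + 3 * realChar p m tauReal +
        3 * realChar p m tauConj := by
  have hP := toGL_mem_unitaryLift det_matP matP_mem_unitaryGroup
  have hM : ((toGL matP det_matP ^ 2 : GL (Fin 3) ℂ) : Matrix (Fin 3) (Fin 3) ℂ) = matP ^ 2 := rfl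
  rw [matP_sq] at hM
  rw [trace_mul_tetrahedral_sum h (pow_mem hP _) hM (fun _ _ => 0)
    ![![tauConj, 0, tauReal, -1], ![tauReal, tauConj, 0, -1], ![0, tauReal, tauConj, -1]] ?_]
  · simp [Fin.sum_univ_three, Fin.sum_univ_four]
    ring
  · have h1 := rho_sq
    have h3 := tau_sq
    intro c s
    fin_cases c <;> fin_cases s <;>
      simp [signs, cyclicDiag, Fin.sum_univ_three, coe_tauConj, coe_tauReal] <;> grind

theorem trace_P_pow_three_tetrahedral_sum {p m : ℕ} (h : 3 ∣ m + p) :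
    LinearMap.trace ℂ _ (formRep 3 p m (toGL matP det_matP ^ 3) *
      tetrahedralSum (formRep 3 p m)) =
      3 * realChar p m (-1) + 3 * realChar p m 0 + 3 * realChar p m tauReal +
        3 * realChar p m tauConj := by
  have hP := toGL_mem_unitaryLift det_matP matP_mem_unitaryGroup
  have hM : ((toGL matP det_matP ^ 3 : GL (Fin 3) ℂ) : Matrix (Fin 3) (Fin 3) ℂ) = matP ^ 3 := rfl
  rw [matP_pow_three] at hM
  rw [trace_mul_tetrahedral_sum h (pow_mem hP _) hM (fun _ _ => 0)
    ![![tauConj, 0, tauReal, -1], ![0, -1, tauReal, tauConj], ![tauReal, 0, -1, tauConj]] ?_]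
  · simp [Fin.sum_univ_three, Fin.sum_univ_four]
    ring
  · have h1 := rho_sq
    have h3 := tau_sq
    intro c s
    fin_cases c <;> fin_cases s <;>
      simp [signs, cyclicDiag, Fin.sum_univ_three, coe_tauConj, coe_tauReal] <;> grind

theorem trace_P_pow_four_tetrahedral_sum {p m : ℕ} (h : 3 ∣ m + p) :
    LinearMap.trace ℂ _ (formRep 3 p m (toGL matP det_matP ^ 4) *
      tetrahedralSum (formRep 3 p m)) =
      3 * realChar p m (-1) + 3 * realChar p m 0 + 3 * realChar p m tauReal +
        3 * realChar p m tauConj := by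
  have hP := toGL_mem_unitaryLift det_matP matP_mem_unitaryGroup
  have hM : ((toGL matP det_matP ^ 4 : GL (Fin 3) ℂ) : Matrix (Fin 3) (Fin 3) ℂ) = matP ^ 4 := rfl
  rw [matP_pow_four] at hM
  rw [trace_mul_tetrahedral_sum h (pow_mem hP _) hM (fun _ _ => 0)
    ![![tauReal, tauConj, 0, -1], ![-1, tauConj, tauReal, 0], ![tauReal, -1, tauConj, 0]] ?_]
  · simp [Fin.sum_univ_three, Fin.sum_univ_four]
    ring
  · have h1 := rho_sq
    have h3 := tau_sq
    intro c s
    fin_cases c <;> fin_cases s <;>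
      simp [signs, cyclicDiag, Fin.sum_univ_three, coe_tauConj, coe_tauReal] <;> grind

/-- From here on the traces carry powers of `ρ`. Where the trace vanishes the exponent is immaterial
and is set to 0. -/
theorem trace_Q_tetrahedral_sum {p m : ℕ} (h : 3 ∣ m + p) :
    LinearMap.trace ℂ _ (formRep 3 p m (toGL matQ det_matQ) *
      tetrahedralSum (formRep 3 p m)) =
      6 * realChar p m (-1) + 6 * realChar p m 1 := by
  have hQ := toGL_mem_unitaryLift det_matQ matQ_mem_unitaryGroup
  have hM : ((toGL matQ det_matQ : GL (Fin 3) ℂ) : Matrix (Fin 3) (Fin 3) ℂ) = matQ := rfl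
  rw [trace_mul_tetrahedral_sum h hQ hM
    ![![0, 0, 0, 0], ![2, 2, 2, 2], ![1, 1, 1, 1]]
    ![![1, 1, -1, -1], ![1, -1, -1, 1], ![-1, 1, -1, 1]] ?_]
  · simp [Fin.sum_univ_three, Fin.sum_univ_four]
    ring
  · have h1 := rho_sq
    have h3 := tau_sq
    intro c s
    fin_cases c <;> fin_cases s <;>
      simp [signs, cyclicDiag, Fin.sum_univ_three, matQ]

theorem trace_Q_P_tetrahedral_sum {p m : ℕ} (h : 3 ∣ m + p) :
    LinearMap.trace ℂ _ (formRep 3 p m (toGL matQ det_matQ * toGL matP det_matP) *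
      tetrahedralSum (formRep 3 p m)) =
      3 * realChar p m 0 + 3 * realChar p m 1 + 3 * realChar p m tauReal +
        3 * realChar p m tauConj := by
  have hP := toGL_mem_unitaryLift det_matP matP_mem_unitaryGroup
  have hQ := toGL_mem_unitaryLift det_matQ matQ_mem_unitaryGroup
  have hM : ((toGL matQ det_matQ * toGL matP det_matP : GL (Fin 3) ℂ) : Matrix (Fin 3) (Fin 3) ℂ) =
    _ := congrArg (matQ * ·) matP_eq
  rw [trace_mul_tetrahedral_sum h (mul_mem hQ hP) hM
    ![![0, 0, 1, 2], ![1, 0, 2, 0], ![2, 0, 0, 1]]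
    ![![1, 0, 1, 1], ![tauConj, 0, tauConj, tauConj], ![tauReal, 0, tauReal, tauReal]] ?_]
  · simp [Fin.sum_univ_three, Fin.sum_univ_four]
    ring
  · have h1 := rho_sq
    have h3 := tau_sq
    intro c s
    fin_cases c <;> fin_cases s <;>
      simp [signs, cyclicDiag, Fin.sum_univ_three, coe_tauConj, coe_tauReal, matQ,
        Matrix.mul_apply] <;> grind

theorem trace_Q_P_sq_tetrahedral_sum {p m : ℕ} (h : 3 ∣ m + p) :
    LinearMap.trace ℂ _ (formRep 3 p m (toGL matQ det_matQ * toGL matP det_matP ^ 2) *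
      tetrahedralSum (formRep 3 p m)) =
      3 * realChar p m 0 + 3 * realChar p m 1 + 3 * realChar p m tauReal +
        3 * realChar p m tauConj := by
  have hP := toGL_mem_unitaryLift det_matP matP_mem_unitaryGroup
  have hQ := toGL_mem_unitaryLift det_matQ matQ_mem_unitaryGroup
  have hM : ((toGL matQ det_matQ * toGL matP det_matP ^ 2 : GL (Fin 3) ℂ) :
      Matrix (Fin 3) (Fin 3) ℂ) =
      matQ * matP ^ 2 := rfl
  rw [matP_sq] at hM
  rw [trace_mul_tetrahedral_sum h (mul_mem hQ (pow_mem hP _)) hM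
    ![![0, 0, 2, 1], ![0, 2, 0, 1], ![2, 0, 0, 1]]
    ![![0, tauConj, tauConj, tauConj], ![tauReal, tauReal, 0, tauReal], ![1, 0, 1, 1]] ?_]
  · simp [Fin.sum_univ_three, Fin.sum_univ_four]
    ring
  · have h1 := rho_sq
    have h3 := tau_sq
    intro c s
    fin_cases c <;> fin_cases s <;>
      simp [signs, cyclicDiag, Fin.sum_univ_three, coe_tauConj, coe_tauReal, matQ,
        Matrix.mul_apply] <;> grind

theorem trace_Q_P_pow_three_tetrahedral_sum {p m : ℕ} (h : 3 ∣ m + p) :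
    LinearMap.trace ℂ _ (formRep 3 p m (toGL matQ det_matQ * toGL matP det_matP ^ 3) *
      tetrahedralSum (formRep 3 p m)) =
      3 * realChar p m 0 + 3 * realChar p m 1 + 3 * realChar p m tauReal +
        3 * realChar p m tauConj := by
  have hP := toGL_mem_unitaryLift det_matP matP_mem_unitaryGroup
  have hQ := toGL_mem_unitaryLift det_matQ matQ_mem_unitaryGroup
  have hM : ((toGL matQ det_matQ * toGL matP det_matP ^ 3 : GL (Fin 3) ℂ) :
      Matrix (Fin 3) (Fin 3) ℂ) =
      matQ * matP ^ 3 := rfl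
  rw [matP_pow_three] at hM
  rw [trace_mul_tetrahedral_sum h (mul_mem hQ (pow_mem hP _)) hM
    ![![0, 0, 1, 2], ![0, 2, 0, 1], ![0, 1, 2, 0]]
    ![![tauConj, 0, tauConj, tauConj], ![tauReal, tauReal, 0, tauReal], ![1, 1, 1, 0]] ?_]
  · simp [Fin.sum_univ_three, Fin.sum_univ_four]
    ring
  · have h1 := rho_sq
    have h3 := tau_sq
    intro c s
    fin_cases c <;> fin_cases s <;>
      simp [signs, cyclicDiag, Fin.sum_univ_three, coe_tauConj, coe_tauReal, matQ,
        Matrix.mul_apply] <;> grind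

theorem trace_Q_P_pow_four_tetrahedral_sum {p m : ℕ} (h : 3 ∣ m + p) :
    LinearMap.trace ℂ _ (formRep 3 p m (toGL matQ det_matQ * toGL matP det_matP ^ 4) *
      tetrahedralSum (formRep 3 p m)) =
      3 * realChar p m 0 + 3 * realChar p m 1 + 3 * realChar p m tauReal +
        3 * realChar p m tauConj := by
  have hP := toGL_mem_unitaryLift det_matP matP_mem_unitaryGroup
  have hQ := toGL_mem_unitaryLift det_matQ matQ_mem_unitaryGroup
  have hM : ((toGL matQ det_matQ * toGL matP det_matP ^ 4 : GL (Fin 3) ℂ) :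
      Matrix (Fin 3) (Fin 3) ℂ) =
      matQ * matP ^ 4 := rfl
  rw [matP_pow_four] at hM
  rw [trace_mul_tetrahedral_sum h (mul_mem hQ (pow_mem hP _)) hM
    ![![0, 0, 2, 1], ![1, 0, 2, 0], ![0, 1, 2, 0]]
    ![![0, 1, 1, 1], ![tauConj, 0, tauConj, tauConj], ![tauReal, tauReal, tauReal, 0]] ?_]
  · simp [Fin.sum_univ_three, Fin.sum_univ_four]
    ring
  · have h1 := rho_sq
    have h3 := tau_sq
    intro c s
    fin_cases c <;> fin_cases s <;>
      simp [signs, cyclicDiag, Fin.sum_univ_three, coe_tauConj, coe_tauReal, matQ,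
        Matrix.mul_apply] <;> grind

/-! ### The dimension of the space of invariant forms -/

/-- The generators of the Valentiner group, lifted to `SU₃`. -/
def generators : Set (GL (Fin 3) ℂ) :=
  {toGL matZ det_matZ, toGL matT det_matT, toGL matP det_matP, toGL matQ det_matQ}

theorem valentinerGroup_eq_map :
    valentinerGroup = (Subgroup.closure generators).map Matrix.ProjGenLinGroup.mk := by
  rw [MonoidHom.map_closure, valentinerGroup, generators]
  simp only [Set.image_insert_eq, Set.image_singleton]

theorem generators_subset_unitaryLift : generators ⊆ (unitaryLift ⊤ ⊥ : Subgroup _) := by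
  rintro g (rfl | rfl | rfl | rfl)
  exacts [toGL_mem_unitaryLift _ matZ_mem_unitaryGroup,
    toGL_mem_unitaryLift _ matT_mem_unitaryGroup, toGL_mem_unitaryLift _ matP_mem_unitaryGroup,
    toGL_mem_unitaryLift _ matQ_mem_unitaryGroup]

theorem closure_generators_le : Subgroup.closure generators ≤ valentiner3 := by
  intro g hg
  have h := (Subgroup.closure_le _).2 generators_subset_unitaryLift hg
  refine ⟨h.1, h.2.1, ?_⟩
  rw [valentinerGroup_eq_map]
  exact Subgroup.mem_map_of_mem _ hg

theorem rho_ne_zero : rho ≠ 0 := Complex.exp_ne_zero _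

theorem scalar_rho_mem_valentiner3 :
    Matrix.GeneralLinearGroup.scalar (Fin 3) (Units.mk0 rho rho_ne_zero) ∈ valentiner3 := by
  have h := toGL_mem_unitaryLift det_scalar_rho scalar_rho_mem_unitaryGroup
  have e : toGL (Matrix.scalar (Fin 3) rho) det_scalar_rho =
      Matrix.GeneralLinearGroup.scalar (Fin 3) (Units.mk0 rho rho_ne_zero) := Units.ext rfl
  rw [e] at h
  refine ⟨h.1, h.2.1, ?_⟩
  rw [Matrix.ProjGenLinGroup.mk_scalar]
  exact one_mem _

/-- Equal projective classes differ by a scalar, and determinant 1 on both sides makes its cube 1.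
-/
theorem exists_mem_closure_of_mem_valentiner3 {T : GL (Fin 3) ℂ} (hT : T ∈ valentiner3) :
    ∃ g ∈ Subgroup.closure generators, ∃ u : ℂˣ, (u : ℂ) ^ 3 = 1 ∧
      T = g * Matrix.GeneralLinearGroup.scalar (Fin 3) u := by
  obtain ⟨-, hdet, hV⟩ := hT
  rw [valentinerGroup_eq_map] at hV
  obtain ⟨g, hg, hgT⟩ := hV
  obtain ⟨u, hu⟩ := Matrix.ProjGenLinGroup.mk_eq_mk_iff.1 hgT
  refine ⟨g, hg, u, ?_, hu.symm⟩
  have h1 : ((T : GL (Fin 3) ℂ) : Matrix (Fin 3) (Fin 3) ℂ).det = 1 :=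
    congrArg Units.val (Subgroup.mem_bot.1 hdet)
  have h2 : ((g : GL (Fin 3) ℂ) : Matrix (Fin 3) (Fin 3) ℂ).det = 1 :=
    congrArg Units.val (Subgroup.mem_bot.1 (closure_generators_le hg).2.1)
  rw [← hu, Units.val_mul, Matrix.det_mul, h2, one_mul] at h1
  simpa using h1

/-- The exponent `k` is 3 for the centre of `valentiner3` and 2 for the scalars `±1` of
`valentiner6`. -/
theorem formRep_scalar {n p m k : ℕ} (h : k ∣ m + p) {u : ℂˣ} (hu : (u : ℂ) ^ k = 1) :
    formRep n p m (Matrix.GeneralLinearGroup.scalar (Fin n) u) = 1 := by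
  have h1 : formRep n p m (Matrix.GeneralLinearGroup.scalar (Fin n) u) =
      homPullback n p m (Matrix.scalar (Fin n) ((u⁻¹ : ℂˣ) : ℂ)) := by
    change homPullback n p m _ = _
    rw [← map_inv]
    rfl
  obtain ⟨l, hl⟩ := h
  rw [h1, homPullback_scalar, hl, pow_mul, Units.val_inv_eq_inv_val, inv_pow, hu]
  simp

theorem formRep_eq_of_eq_mul_scalar {p m : ℕ} (h : 3 ∣ m + p) {g g' : GL (Fin 3) ℂ} (k : ℕ)
    (hg : (g : Matrix (Fin 3) (Fin 3) ℂ) = g' * Matrix.scalar (Fin 3) rho ^ k) :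
    formRep 3 p m g = formRep 3 p m g' := by
  have h1 : g = g' * Matrix.GeneralLinearGroup.scalar (Fin 3) (Units.mk0 rho rho_ne_zero) ^ k := by
    apply Units.ext
    rw [hg, Units.val_mul, Units.val_pow_eq_pow_val, Matrix.GeneralLinearGroup.coe_scalar,
      Units.val_mk0]
  have h2 := formRep_scalar (n := 3) h (u := Units.mk0 rho rho_ne_zero) rho_pow_three
  rw [h1, map_mul, map_pow, h2, one_pow, mul_one]

theorem invariantForms_le_homForms {n p m : ℕ} (G : Subgroup (GL (Fin n) ℂ)) :
    invariantForms G p m ≤ homForms n p m := fun _ h => h.1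

theorem mem_invariantForms_iff {n p m : ℕ} {G : Subgroup (GL (Fin n) ℂ)} {ω : homForms n p m} :
    (ω : PolyForm n p) ∈ invariantForms G p m ↔ ∀ T ∈ G, formRep n p m T ω = ω :=
  ⟨fun h T hT => Subtype.ext (h.2 T hT), fun h => ⟨ω.2, fun T hT => congrArg Subtype.val (h T hT)⟩⟩

theorem formRep_eq_self_of_mem_closure {n p m : ℕ} {S : Set (GL (Fin n) ℂ)} {ω : homForms n p m}
    (H : ∀ T ∈ S, formRep n p m T ω = ω) {g : GL (Fin n) ℂ} (hg : g ∈ Subgroup.closure S) :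
    formRep n p m g ω = ω := by
  induction hg using Subgroup.closure_induction with
  | mem x hx => exact H x hx
  | one => simp
  | mul x y hx hy h1 h2 => rw [map_mul, Module.End.mul_apply, h2, h1]
  | inv x hx h1 =>
    conv_lhs => rw [← h1]
    rw [← Module.End.mul_apply, ← map_mul, inv_mul_cancel, map_one, Module.End.one_apply]

theorem mem_invariantForms_valentiner3_iff {p m : ℕ} (h : 3 ∣ m + p) {ω : homForms 3 p m} :
    (ω : PolyForm 3 p) ∈ invariantForms valentiner3 p m ↔
      ∀ T ∈ generators, formRep 3 p m T ω = ω := by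
  rw [mem_invariantForms_iff]
  refine ⟨fun H T hT => H T (closure_generators_le (Subgroup.subset_closure hT)), fun H T hT => ?_⟩
  obtain ⟨g, hg, u, hu, rfl⟩ := exists_mem_closure_of_mem_valentiner3 hT
  rw [map_mul, formRep_scalar h hu, mul_one]
  exact formRep_eq_self_of_mem_closure H hg

theorem rho_pow_ne_one {k : ℕ} (h : ¬ 3 ∣ k) : rho ^ k ≠ 1 := fun h1 =>
  h ((Complex.isPrimitiveRoot_exp 3 (by norm_num)).dvd_of_pow_eq_one k h1)

theorem invariantForms_eq_bot_of_scalar_mem {n p m : ℕ} {G : Subgroup (GL (Fin n) ℂ)} {u : ℂˣ}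
    (hu : Matrix.GeneralLinearGroup.scalar (Fin n) u ∈ G) (h : (u : ℂ) ^ (m + p) ≠ 1) :
    invariantForms G p m = ⊥ := by
  rw [eq_bot_iff]
  intro ω hω
  have h1 := (mem_invariantForms_iff (ω := ⟨ω, hω.1⟩)).1 hω _ (inv_mem hu)
  have h2 : homPullback n p m (Matrix.scalar (Fin n) (u : ℂ)) ⟨ω, hω.1⟩ = ⟨ω, hω.1⟩ := by
    refine Eq.trans ?_ h1
    change _ = homPullback n p m _ _
    rw [inv_inv]
    rfl
  rw [homPullback_scalar, LinearMap.smul_apply, Module.End.one_apply, Subtype.ext_iff] at h2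
  change (u : ℂ) ^ (m + p) • ω = ω at h2
  ext1 v
  have h3 : (u : ℂ) ^ (m + p) • ω v = ω v := DFunLike.congr_fun h2 v
  have h4 : ((u : ℂ) ^ (m + p) - 1) • ω v = 0 := by rw [sub_smul, h3, one_smul, sub_self]
  exact (smul_eq_zero.1 h4).resolve_left (sub_ne_zero.2 h)

theorem invariantForms_valentiner3_eq_bot {p m : ℕ} (h : ¬ 3 ∣ m + p) :
    invariantForms valentiner3 p m = ⊥ :=
  invariantForms_eq_bot_of_scalar_mem scalar_rho_mem_valentiner3 (rho_pow_ne_one h)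

/-- The dimension of the invariants of a representation of the Valentiner group in terms of
traces. -/
theorem finrank_fixed_eq {V : Type*} [AddCommGroup V] [Module ℂ V] [FiniteDimensional ℂ V]
    (R : GL (Fin 3) ℂ →* Module.End ℂ V)
    (relS : ∀ (g g' : GL (Fin 3) ℂ) (k : ℕ),
      (g : Matrix (Fin 3) (Fin 3) ℂ) = g' * Matrix.scalar (Fin 3) rho ^ k → R g = R g')
    (W : Submodule ℂ V) (hW : ∀ v, v ∈ W ↔ ∀ T ∈ generators, R T v = v)
    (f g : Fin 5 → ℂ)
    (hf : ∀ a : Fin 5, LinearMap.trace ℂ V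
      (R (toGL matP det_matP ^ (a : ℕ)) * tetrahedralSum R) = f a)
    (hg : ∀ a : Fin 5, LinearMap.trace ℂ V
      (R (toGL matQ det_matQ * toGL matP det_matP ^ (a : ℕ)) * tetrahedralSum R) = g a) :
    (360 : ℂ) * Module.finrank ℂ W = ∑ a, f a + 5 * ∑ a, g a := by
  simp only [← hf, ← hg]
  obtain ⟨z, hz⟩ : ∃ z, z = toGL matZ det_matZ := ⟨_, rfl⟩
  obtain ⟨y, hy⟩ : ∃ y, y = toGL matY det_matY := ⟨_, rfl⟩
  obtain ⟨t, ht⟩ : ∃ t, t = toGL matT det_matT := ⟨_, rfl⟩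
  obtain ⟨q, hq⟩ : ∃ q, q = toGL matQ det_matQ := ⟨_, rfl⟩
  obtain ⟨b, hb⟩ : ∃ b, b = toGL matP det_matP := ⟨_, rfl⟩
  have hz' : (z : Matrix (Fin 3) (Fin 3) ℂ) = matZ := by rw [hz]; rfl
  have hy' : (y : Matrix (Fin 3) (Fin 3) ℂ) = matY := by rw [hy]; rfl
  have ht' : (t : Matrix (Fin 3) (Fin 3) ℂ) = matT := by rw [ht]; rfl
  have hq' : (q : Matrix (Fin 3) (Fin 3) ℂ) = matQ := by rw [hq]; rfl
  have hb' : (b : Matrix (Fin 3) (Fin 3) ℂ) = matP := by rw [hb]; rfl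
  have rel {g g' : GL (Fin 3) ℂ}
      (hg : (g : Matrix (Fin 3) (Fin 3) ℂ) = g') : R g = R g' := congrArg R (Units.ext hg)
  obtain ⟨e, he⟩ : ∃ e, e = (1 + R b + R b ^ 2 + R b ^ 3 + R b ^ 4) * tetrahedralSum R :=
    ⟨_, rfl⟩
  obtain ⟨A, hA⟩ : ∃ A, A = e + (1 + R b + R b ^ 2 + R b ^ 3 + R b ^ 4) * (R q * e) := ⟨_, rfl⟩
  obtain ⟨⟨hzA, htA, hbA, hqA⟩, hee, hA2⟩ :=
    valentiner_group_algebra (z := R z) (y := R y) (t := R t) (p := R b) (q := R q)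
      (by rw [← map_mul, ← map_one R]; apply rel; simp [hz', matZ_mul_matZ])
      (by rw [← map_mul, ← map_one R]; apply rel; simp [hy', matY_mul_matY])
      (by simp only [← map_mul]; apply rel; simp [hz', hy', matY_mul_matZ])
      (by simp only [← map_mul]; apply rel; simp [hz', hy', ht', matT_mul_matZ])
      (by simp only [← map_mul]; apply rel; simp [hz', hy', ht', matT_mul_matY])
      (by simp only [← map_mul]; rw [← map_one R]; apply rel; simp [ht', matT_mul_matT])
      (by simp only [← map_mul, ← map_pow]; rw [← map_one R]; apply rel
          simp [hb', matP_mul_pow_four])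
      (by simp only [← map_mul, ← map_pow]; apply rel; simp [hz', hy', ht', hb', matZ_mul_matP])
      (by simp only [← map_mul, ← map_pow]; apply rel
          simp [hz', hy', ht', hb', matZ_mul_matP_sq])
      (by simp only [← map_mul, ← map_pow]; apply rel
          simp [hz', ht', hb', matZ_mul_matP_pow_three])
      (by simp only [← map_mul, ← map_pow]; apply rel
          simp [hz', hy', ht', hb', matZ_mul_matP_pow_four])
      (by simp only [← map_mul, ← map_pow]; apply rel; simp [hy', ht', hb', matT_mul_matP])
      (by simp only [← map_mul, ← map_pow]; apply rel; simp [hz', ht', hb', matT_mul_matP_sq])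
      (by simp only [← map_mul, ← map_pow]; apply rel
          simp [hy', ht', hb', matT_mul_matP_pow_three])
      (by simp only [← map_mul, ← map_pow]; apply rel; simp [ht', hb', matT_mul_matP_pow_four])
      (by simp only [← map_mul]; apply rel; simp [hz', hq', matQ_mul_matQ])
      (by simp only [← map_mul]; apply rel; simp [hz', hq', matZ_mul_matQ])
      (by simp only [← map_mul, ← map_pow]; apply relS _ _ 1
          simpa only [Units.val_mul, Units.val_pow_eq_pow_val, hz', hy', ht', hq', pow_one]
            using matT_mul_matQ)
      (by simp only [← map_mul, ← map_pow]; apply relS _ _ 2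
          simpa only [Units.val_mul, Units.val_pow_eq_pow_val, hy', ht', hq', hb']
            using matQ_mul_matP_mul_matQ)
      (by simp only [← map_mul, ← map_pow]; apply rel
          simpa only [Units.val_mul, Units.val_pow_eq_pow_val, hz', ht', hq', hb']
            using matQ_mul_matP_sq_mul_matQ)
      (by simp only [← map_mul, ← map_pow]; apply relS _ _ 1
          simpa only [Units.val_mul, Units.val_pow_eq_pow_val, hz', hy', ht', hq', hb', pow_one]
            using matQ_mul_matP_pow_three_mul_matQ)
      (by simp only [← map_mul, ← map_pow]; apply rel
          simpa only [Units.val_mul, Units.val_pow_eq_pow_val, hz', hy', ht', hq', hb']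
            using matQ_mul_matP_pow_four_mul_matQ)
      e A (by rw [he, tetrahedralSum, hz, hy, ht]) hA
  -- The image of `A` is fixed by the generators, and on a fixed vector each of the 360 summands
  -- acts as the identity.
  have htr : LinearMap.trace ℂ _ ((1 / 360 : ℂ) • A) = Module.finrank ℂ W := by
    refine trace_eq_finrank_of_projection W _ (fun v => ?_) fun v hv => ?_
    · refine W.smul_mem _ ((hW _).2 ?_)
      rintro T (rfl | rfl | rfl | rfl)
      · exact DFunLike.congr_fun (hz ▸ hzA) v
      · exact DFunLike.congr_fun (ht ▸ htA) v
      · exact DFunLike.congr_fun (hb ▸ hbA) v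
      · exact DFunLike.congr_fun (hq ▸ hqA) v
    · have H := (hW v).1 hv
      have hzv : R z v = v := H _ (by simp [generators, hz])
      have htv : R t v = v := H _ (by simp [generators, ht])
      have hqv : R q v = v := H _ (by simp [generators, hq])
      have hbv : R b v = v := H _ (by simp [generators, hb])
      have hyv : R y v = v := by
        have h1 : R t * R z = R y * R t := by
          simp only [← map_mul]; apply rel; simp [hz', hy', ht', matT_mul_matZ]
        have h2 := DFunLike.congr_fun h1 v
        simpa only [Module.End.mul_apply, hzv, htv, eq_comm] using h2
      rw [hA, he, tetrahedralSum, ← hz, ← hy, ← ht]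
      simp only [LinearMap.smul_apply, LinearMap.add_apply, Module.End.mul_apply, pow_succ,
        pow_zero, one_mul, map_add, hzv, hyv, htv, hqv, hbv, Module.End.one_apply]
      module
  -- With `A = e + (1/12) e q e` and `e² = 60 e`, the second term has trace `(60/12) tr(q e) = 5
  -- tr(q e)`.
  have hqe : LinearMap.trace ℂ _ (e * (R q * e)) = 60 * LinearMap.trace ℂ _ (R q * e) := by
    rw [LinearMap.trace_mul_comm, mul_assoc, hee, mul_smul_comm, map_smul, smul_eq_mul]
  have hte : e = ∑ a : Fin 5, R (b ^ (a : ℕ)) * tetrahedralSum R := by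
    rw [he, Fin.sum_univ_five]
    simp [add_mul]
  have htqe : R q * e = ∑ a : Fin 5, R (q * b ^ (a : ℕ)) * tetrahedralSum R := by
    rw [hte, Finset.mul_sum]
    simp only [map_mul, mul_assoc]
  rw [← hb, ← hq, ← map_sum, ← map_sum, ← hte, ← htqe, ← htr, hA2, map_smul, map_add, map_smul, hqe]
  simp only [smul_eq_mul]
  ring

/-- The sum of the characters over the `360` elements of the Valentiner group. -/
def charSum (p m : ℕ) : ℂ :=
  realChar p m 3 + 45 * realChar p m (-1) + 80 * realChar p m 0 + 90 * realChar p m 1 +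
    72 * realChar p m tauReal + 72 * realChar p m tauConj

theorem trace_P_pow_tetrahedral_sum {p m : ℕ} (h : 3 ∣ m + p) (a : Fin 5) :
    LinearMap.trace ℂ _
      (formRep 3 p m (toGL matP det_matP ^ (a : ℕ)) * tetrahedralSum (formRep 3 p m)) =
    ![realChar p m 3 + 3 * realChar p m (-1) + 8 * realChar p m 0,
      3 * realChar p m (-1) + 3 * realChar p m 0 + 3 * realChar p m tauReal +
        3 * realChar p m tauConj,
      3 * realChar p m (-1) + 3 * realChar p m 0 + 3 * realChar p m tauReal +
        3 * realChar p m tauConj,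
      3 * realChar p m (-1) + 3 * realChar p m 0 + 3 * realChar p m tauReal +
        3 * realChar p m tauConj,
      3 * realChar p m (-1) + 3 * realChar p m 0 + 3 * realChar p m tauReal +
        3 * realChar p m tauConj] a := by
  have h0 := trace_tetrahedral_sum h
  have h1 := trace_P_tetrahedral_sum h
  have h2 := trace_P_sq_tetrahedral_sum h
  have h3 := trace_P_pow_three_tetrahedral_sum h
  have h4 := trace_P_pow_four_tetrahedral_sum h
  rw [← pow_zero (toGL matP det_matP)] at h0
  rw [← pow_one (toGL matP det_matP)] at h1
  fin_cases a
  exacts [h0, h1, h2, h3, h4]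

theorem trace_Q_P_pow_tetrahedral_sum {p m : ℕ} (h : 3 ∣ m + p) (a : Fin 5) :
    LinearMap.trace ℂ _ (formRep 3 p m (toGL matQ det_matQ * toGL matP det_matP ^ (a : ℕ)) *
      tetrahedralSum (formRep 3 p m)) =
    ![6 * realChar p m (-1) + 6 * realChar p m 1,
      3 * realChar p m 0 + 3 * realChar p m 1 + 3 * realChar p m tauReal +
        3 * realChar p m tauConj,
      3 * realChar p m 0 + 3 * realChar p m 1 + 3 * realChar p m tauReal +
        3 * realChar p m tauConj,
      3 * realChar p m 0 + 3 * realChar p m 1 + 3 * realChar p m tauReal +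
        3 * realChar p m tauConj,
      3 * realChar p m 0 + 3 * realChar p m 1 + 3 * realChar p m tauReal +
        3 * realChar p m tauConj] a := by
  have h0 := trace_Q_tetrahedral_sum h
  have h1 := trace_Q_P_tetrahedral_sum h
  have h2 := trace_Q_P_sq_tetrahedral_sum h
  have h3 := trace_Q_P_pow_three_tetrahedral_sum h
  have h4 := trace_Q_P_pow_four_tetrahedral_sum h
  rw [← mul_one (toGL matQ det_matQ), ← pow_zero (toGL matP det_matP)] at h0
  rw [← pow_one (toGL matP det_matP)] at h1
  fin_cases a
  exacts [h0, h1, h2, h3, h4]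

theorem finrank_invariantForms_valentiner3 {p m : ℕ} (h : 3 ∣ m + p) :
    (360 : ℂ) * Module.finrank ℂ (invariantForms valentiner3 p m) = charSum p m := by
  let W := (invariantForms valentiner3 p m).comap (homForms 3 p m).subtype
  have hW : Module.finrank ℂ (invariantForms valentiner3 p m) = Module.finrank ℂ W :=
    (Submodule.comapSubtypeEquivOfLe (invariantForms_le_homForms valentiner3)).finrank_eq.symm
  rw [hW]
  have key := finrank_fixed_eq (V := homForms 3 p m) (formRep 3 p m)
    (fun g g' k => formRep_eq_of_eq_mul_scalar h k) W
    (fun v => mem_invariantForms_valentiner3_iff h) _ _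
    (fun a => trace_P_pow_tetrahedral_sum h a) (fun a => trace_Q_P_pow_tetrahedral_sum h a)
  rw [key]
  -- The first family counts the icosahedral classes (1, 15, 20, 12, 12 elements); five times the
  -- second counts the other 300 elements.
  simp only [Fin.sum_univ_five, Matrix.cons_val]
  rw [charSum]
  ring

/-! ### Generating functions -/

open PowerSeries in
/-- The terms of a power series whose degree is `-r` modulo `d`. -/
def residueFilter (d r : ℕ) : PowerSeries ℂ →ₗ[ℂ] PowerSeries ℂ where
  toFun f := mk fun m => if d ∣ m + r then coeff m f else 0
  map_add' f g := by ext m; simp only [coeff_mk, map_add]; split_ifs <;> simp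
  map_smul' c f := by ext m; simp

theorem coeff_residueFilter (d r m : ℕ) (f : PowerSeries ℂ) :
    PowerSeries.coeff m (residueFilter d r f) =
      if d ∣ m + r then PowerSeries.coeff m f else 0 := by
  simp [residueFilter]

theorem residueFilter_X_pow (d r n : ℕ) :
    residueFilter d r (PowerSeries.X ^ n) = if d ∣ n + r then PowerSeries.X ^ n else 0 := by
  ext m
  rw [coeff_residueFilter, PowerSeries.coeff_X_pow]
  by_cases h : m = n
  · subst h
    by_cases hd : d ∣ m + r <;> simp [hd]
  · split_ifs <;> simp [PowerSeries.coeff_X_pow, h]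

/-- Multiplication by `X ^ k` with `d ∣ k` preserves the residue of degrees modulo `d`. -/
theorem residueFilter_one_sub_X_pow_mul {d k : ℕ} (r : ℕ) (h : d ∣ k) (f : PowerSeries ℂ) :
    residueFilter d r ((1 - PowerSeries.X ^ k) * f) =
      (1 - PowerSeries.X ^ k) * residueFilter d r f := by
  rw [sub_mul, sub_mul, one_mul, one_mul, map_sub]
  congr 1
  ext m
  rw [coeff_residueFilter, PowerSeries.coeff_X_pow_mul', PowerSeries.coeff_X_pow_mul',
    coeff_residueFilter]
  by_cases hk : k ≤ m
  · have : d ∣ m + r ↔ d ∣ m - k + r := by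
      rw [← Nat.dvd_add_left h (b := m - k + r), add_right_comm, Nat.sub_add_cancel hk]
    simp [hk, this]
  · simp [hk]

open PowerSeries in
/-- The denominator `(1 - t⁶)(1 - t¹²)(1 - t³⁰)` of the Molien series. -/
def molienDenominator (R : Type*) [CommRing R] : PowerSeries R :=
  (1 - X ^ 6) * ((1 - X ^ 12) * (1 - X ^ 30))

theorem residueFilter_molienDenominator_mul {d : ℕ} (r : ℕ) (h : d ∣ 6) (f : PowerSeries ℂ) :
    residueFilter d r (molienDenominator ℂ * f) =
      molienDenominator ℂ * residueFilter d r f := by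
  rw [molienDenominator, mul_assoc, mul_assoc, residueFilter_one_sub_X_pow_mul _ h,
    residueFilter_one_sub_X_pow_mul _ (h.trans (by norm_num)),
    residueFilter_one_sub_X_pow_mul _ (h.trans (by norm_num)), mul_assoc, mul_assoc]

/-- The generating function of the character sums. -/
def charSeries (p : ℕ) : PowerSeries ℂ :=
  PowerSeries.C (extChar p (3 : ℝ)) * symChar (3 : ℝ) +
    45 * (PowerSeries.C (extChar p (-1 : ℝ)) * symChar (-1 : ℝ)) +
    80 * (PowerSeries.C (extChar p (0 : ℝ)) * symChar (0 : ℝ)) +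
    90 * (PowerSeries.C (extChar p (1 : ℝ)) * symChar (1 : ℝ)) +
    72 * (PowerSeries.C (extChar p tauReal) * symChar tauReal) +
    72 * (PowerSeries.C (extChar p tauConj) * symChar tauConj)

theorem coeff_charSeries (p m : ℕ) : PowerSeries.coeff m (charSeries p) = charSum p m := by
  have h (k : ℕ) [k.AtLeastTwo] (f : PowerSeries ℂ) :
      PowerSeries.coeff m (ofNat(k) * f) = ofNat(k) * PowerSeries.coeff m f := by
    rw [← map_ofNat (PowerSeries.C (R := ℂ)) k, PowerSeries.coeff_C_mul]
  simp only [charSeries, charSum, map_add, h, PowerSeries.coeff_C_mul, realChar, formChar]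

/-- For each of the six traces the cubic `det(1 - t A)` divides the common denominator; `E` is the
cofactor. -/
theorem symChar_mul_eq {c : ℝ} {E : PowerSeries ℂ}
    (h : (1 - PowerSeries.C (c : ℂ) * PowerSeries.X +
      PowerSeries.C (c : ℂ) * PowerSeries.X ^ 2 - PowerSeries.X ^ 3) * E = molienDenominator ℂ) :
    molienDenominator ℂ * symChar c = E := by
  rw [← h, symChar, Complex.star_def, Complex.conj_ofReal, mul_assoc, mul_comm E, ← mul_assoc,
    PowerSeries.mul_inv_cancel _ (by simp), one_mul]

section

open PowerSeries

theorem molienDenominator_mul_symChar_three :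
    molienDenominator ℂ * symChar (3 : ℝ) = (∑ i ∈ Finset.range 6, X ^ i) *
      ((∑ i ∈ Finset.range 12, X ^ i) * ∑ i ∈ Finset.range 30, X ^ i) := by
  refine symChar_mul_eq ?_
  rw [molienDenominator, ← mul_neg_geom_sum, ← mul_neg_geom_sum, ← mul_neg_geom_sum]
  simp only [Complex.ofReal_ofNat, map_ofNat]
  ring

theorem molienDenominator_mul_symChar_neg_one :
    molienDenominator ℂ * symChar (-1 : ℝ) = (1 + X ^ 2 + X ^ 4) *
      (((1 - X) * (1 + X ^ 2 + X ^ 4 + X ^ 6 + X ^ 8 + X ^ 10)) * (1 - X ^ 30)) := by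
  refine symChar_mul_eq ?_
  rw [molienDenominator]
  simp only [Complex.ofReal_neg, Complex.ofReal_one, map_neg, map_one]
  ring

theorem molienDenominator_mul_symChar_zero :
    molienDenominator ℂ * symChar (0 : ℝ) = (1 + X ^ 3) * ((1 - X ^ 12) * (1 - X ^ 30)) := by
  refine symChar_mul_eq ?_
  rw [molienDenominator]
  simp only [Complex.ofReal_zero, map_zero]
  ring

theorem molienDenominator_mul_symChar_one :
    molienDenominator ℂ * symChar (1 : ℝ) = (1 - X ^ 6) *
      (((1 + X) * (1 + X ^ 4 + X ^ 8)) * (1 - X ^ 30)) := by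
  refine symChar_mul_eq ?_
  rw [molienDenominator]
  simp only [Complex.ofReal_one, map_one]
  ring

/-- Elements of order five: the cubic is `(1 - t)(1 + (1 - c)t + t²)`, and `1 + ct + t²` supplies
the other two primitive fifth roots of unity, completing it to `1 - t⁵`. -/
theorem molienDenominator_mul_symChar_of_sq_eq {c : ℝ} (hc : c ^ 2 = c + 1) :
    molienDenominator ℂ * symChar c = (1 + C (c : ℂ) * X + X ^ 2) * ((1 - X ^ 6) *
      ((1 - X ^ 12) * (1 + X ^ 5 + X ^ 10 + X ^ 15 + X ^ 20 + X ^ 25))) := by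
  refine symChar_mul_eq ?_
  have h : (C (c : ℂ) : PowerSeries ℂ) ^ 2 = C (c : ℂ) + 1 := by
    rw [← map_pow, ← map_one C, ← map_add]
    congr 1
    exact_mod_cast hc
  have h5 : (1 - C (c : ℂ) * X + C (c : ℂ) * X ^ 2 - X ^ 3) * (1 + C (c : ℂ) * X + X ^ 2) =
      1 - (X : PowerSeries ℂ) ^ 5 := by
    linear_combination (X ^ 3 - X ^ 2) * h
  rw [← mul_assoc, h5, molienDenominator]
  ring

theorem tauReal_sq : tauReal ^ 2 = tauReal + 1 := Real.goldenRatio_sq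

theorem tauConj_eq : tauConj = 1 - tauReal := rfl

theorem tauConj_sq : tauConj ^ 2 = tauConj + 1 := by
  rw [tauConj_eq]
  linear_combination tauReal_sq

theorem C_tauReal_sq : (C (tauReal : ℂ) : PowerSeries ℂ) ^ 2 = C (tauReal : ℂ) + 1 := by
  rw [← map_pow, ← map_one C, ← map_add]
  congr 1
  exact_mod_cast tauReal_sq

theorem C_tauConj : (C (tauConj : ℂ) : PowerSeries ℂ) = 1 - C (tauReal : ℂ) := by
  rw [← map_one C, ← map_sub]
  congr 1
  exact_mod_cast tauConj_eq

/-- This serves `p = 0` and `p = 3`. Degrees with `3 ∤ m + p` still occur; their coefficients are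
not dimensions and are filtered out later. -/
theorem molienDenominator_mul_charSeries_of_extChar_eq_one {p : ℕ} (h : ∀ x : ℝ, extChar p x = 1) :
    molienDenominator ℂ * charSeries p = 120 • (
        3 • (X ^ 0 + X ^ 20 + X ^ 25 + X ^ 45) + 2 • (X ^ 2 + X ^ 4 + X ^ 10 + X ^ 35 + X ^ 41 +
        X ^ 43) + (X ^ 1 + X ^ 5 + X ^ 8 + X ^ 37 + X ^ 40 + X ^ 44) - 2 • (X ^ 11 + X ^ 13 + X
        ^ 32 + X ^ 34) - (X ^ 7 + X ^ 14 + X ^ 31 + X ^ 38)) := by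
  have h3 := molienDenominator_mul_symChar_three
  have hn := molienDenominator_mul_symChar_neg_one
  have h0 := molienDenominator_mul_symChar_zero
  have h1 := molienDenominator_mul_symChar_one
  have ht := molienDenominator_mul_symChar_of_sq_eq tauReal_sq
  have hc := molienDenominator_mul_symChar_of_sq_eq tauConj_sq
  have hs := C_tauReal_sq
  rw [C_tauConj] at hc
  simp only [Finset.sum_range_succ, Finset.sum_range_zero] at h3
  rw [charSeries]
  simp only [h]
  simp only [Complex.ofReal_one, Complex.ofReal_ofNat, Complex.ofReal_zero,
    Complex.ofReal_neg, map_one] at h3 hn h0 h1 ⊢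
  linear_combination h3 + 45 * hn + 80 * h0 + 90 * h1 + 72 * ht + 72 * hc

theorem molienDenominator_mul_charSeries_of_extChar_eq_self {p : ℕ} (h : ∀ x : ℝ, extChar p x = x) :
    molienDenominator ℂ * charSeries p = 120 • (
        3 • (X ^ 1 + X ^ 5 + X ^ 9 + X ^ 11 + X ^ 16 + X ^ 19 + X ^ 20 + X ^ 21 + X ^ 24 + X ^
        25 + X ^ 26 + X ^ 29 + X ^ 34 + X ^ 36 + X ^ 40 + X ^ 44) + 2 • (X ^ 15 + X ^ 30) + (X ^
        0 + X ^ 3 + X ^ 42 + X ^ 45) - (X ^ 12 + X ^ 33)) := by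
  have h3 := molienDenominator_mul_symChar_three
  have hn := molienDenominator_mul_symChar_neg_one
  have h0 := molienDenominator_mul_symChar_zero
  have h1 := molienDenominator_mul_symChar_one
  have ht := molienDenominator_mul_symChar_of_sq_eq tauReal_sq
  have hc := molienDenominator_mul_symChar_of_sq_eq tauConj_sq
  have hs := C_tauReal_sq
  rw [C_tauConj] at hc
  simp only [Finset.sum_range_succ, Finset.sum_range_zero] at h3
  rw [charSeries]
  simp only [h]
  simp only [Complex.ofReal_one, Complex.ofReal_ofNat, Complex.ofReal_zero,
    Complex.ofReal_neg, map_one, map_zero, map_neg, map_ofNat, C_tauConj] at h3 hn h0 h1 ⊢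
  -- The weights are class size times trace. The two golden classes produce `72(τ² + (1 - τ)²) =
  -- 72(2τ² - 2τ + 1)`, hence the coefficient 144 of `hs`.
  linear_combination 3 * h3 - 45 * hn + 90 * h1 + 72 * C (tauReal : ℂ) * ht +
    72 * (1 - C (tauReal : ℂ)) * hc + 144 * X * ((1 - X ^ 6) *
      ((1 - X ^ 12) * (1 + X ^ 5 + X ^ 10 + X ^ 15 + X ^ 20 + X ^ 25))) * hs

end

/-! ### The Molien series -/

/-- The generating function of the dimensions of the spaces of invariant `p`-forms. -/
def formSeries (G : Subgroup (GL (Fin 3) ℂ)) (p : ℕ) : PowerSeries ℚ :=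
  PowerSeries.mk fun m => (Module.finrank ℂ (invariantForms G p m) : ℚ)

theorem map_formSeries_valentiner3 (p : ℕ) :
    360 • PowerSeries.map (algebraMap ℚ ℂ) (formSeries valentiner3 p) =
      residueFilter 3 p (charSeries p) := by
  ext m
  rw [coeff_residueFilter, coeff_charSeries, map_nsmul, PowerSeries.coeff_map, formSeries,
    PowerSeries.coeff_mk]
  split_ifs with h
  · rw [← finrank_invariantForms_valentiner3 h]
    simp
  · rw [invariantForms_valentiner3_eq_bot h]
    simp

theorem map_molienDenominator :
    PowerSeries.map (algebraMap ℚ ℂ) (molienDenominator ℚ) = molienDenominator ℂ := by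
  simp [molienDenominator]

/-- The factors 120 and 3 multiply to the order 360, which cancels. -/
theorem molienDenominator_mul_formSeries_of_filter {p : ℕ} {f g : PowerSeries ℂ}
    {N : PowerSeries ℚ} (h : molienDenominator ℂ * charSeries p = 120 • f)
    (hf : residueFilter 3 p f = 3 • g) (hg : g = PowerSeries.map (algebraMap ℚ ℂ) N) :
    molienDenominator ℚ * formSeries valentiner3 p = N := by
  apply PowerSeries.map_injective (algebraMap ℚ ℂ) (algebraMap ℚ ℂ).injective
  have h1 := residueFilter_molienDenominator_mul p (by norm_num : 3 ∣ 6) (charSeries p)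
  rw [h, map_nsmul, hf, ← map_formSeries_valentiner3, mul_smul_comm, hg, smul_smul] at h1
  rw [map_mul, map_molienDenominator]
  have h2 : (360 : ℂ) • PowerSeries.map (algebraMap ℚ ℂ) N = (360 : ℂ) •
      (molienDenominator ℂ * PowerSeries.map (algebraMap ℚ ℂ) (formSeries valentiner3 p)) := by
    rw [← Nat.cast_smul_eq_nsmul ℂ, ← Nat.cast_smul_eq_nsmul ℂ] at h1
    convert h1 using 2 <;> norm_num
  exact (smul_right_injective _ (by norm_num : (360 : ℂ) ≠ 0) h2).symm

open PowerSeries in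
theorem molienDenominator_mul_formSeries_zero :
    molienDenominator ℚ * formSeries valentiner3 0 = 1 + X ^ 45 := by
  refine molienDenominator_mul_formSeries_of_filter (g := X ^ 0 + X ^ 45)
    (molienDenominator_mul_charSeries_of_extChar_eq_one fun x => rfl) ?_ (by simp)
  simp only [map_add, map_sub, map_nsmul, residueFilter_X_pow]
  norm_num

open PowerSeries in
theorem molienDenominator_mul_formSeries_three :
    molienDenominator ℚ * formSeries valentiner3 3 = 1 + X ^ 45 := by
  refine molienDenominator_mul_formSeries_of_filter (g := X ^ 0 + X ^ 45)
    (molienDenominator_mul_charSeries_of_extChar_eq_one fun x => rfl) ?_ (by simp)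
  simp only [map_add, map_sub, map_nsmul, residueFilter_X_pow]
  norm_num

open PowerSeries in
-- One unfiltered numerator serves 1-forms and 2-forms: degrees `≡ 2` modulo 3 belong to the former,
-- `≡ 1` to the latter. It is symmetric under `m ↦ 45 - m`, which exchanges these residues; this is
-- the source of the duality.
theorem molienDenominator_mul_formSeries_one :
    molienDenominator ℚ * formSeries valentiner3 1 =
      X ^ 5 + X ^ 11 + X ^ 20 + X ^ 26 + X ^ 29 + X ^ 44 := by
  refine molienDenominator_mul_formSeries_of_filter
    (g := X ^ 5 + X ^ 11 + X ^ 20 + X ^ 26 + X ^ 29 + X ^ 44)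
    (molienDenominator_mul_charSeries_of_extChar_eq_self fun x => rfl) ?_ (by simp)
  simp only [map_add, map_sub, map_nsmul, residueFilter_X_pow]
  norm_num

open PowerSeries in
theorem molienDenominator_mul_formSeries_two :
    molienDenominator ℚ * formSeries valentiner3 2 =
      X + X ^ 16 + X ^ 19 + X ^ 25 + X ^ 34 + X ^ 40 := by
  refine molienDenominator_mul_formSeries_of_filter
    (g := X ^ 1 + X ^ 16 + X ^ 19 + X ^ 25 + X ^ 34 + X ^ 40)
    (molienDenominator_mul_charSeries_of_extChar_eq_self fun x => Complex.conj_ofReal x) ?_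
    (by simp)
  simp only [map_add, map_sub, map_nsmul, residueFilter_X_pow]
  norm_num

/-! ### The invariant polynomials of the larger lift -/

theorem finrank_invariantPolys {n : ℕ} (G : Subgroup (GL (Fin n) ℂ)) (m : ℕ) :
    Module.finrank ℂ (invariantPolys G m) = Module.finrank ℂ (invariantForms G 0 m) := by
  let e : MvPolynomial (Fin n) ℂ ≃ₗ[ℂ] PolyForm n 0 := AlternatingMap.constLinearEquivOfIsEmpty
  have h : (invariantPolys G m).map e.toLinearMap = invariantForms G 0 m := by
    ext ω
    obtain ⟨f, rfl⟩ := e.surjective ω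
    rw [Submodule.mem_map_equiv, e.symm_apply_apply]
    refine and_congr ⟨fun h v => h, fun h => h 0⟩ (forall₂_congr fun T _ => ?_)
    exact e.injective.eq_iff.symm
  rw [← h]
  exact (e.submoduleMap (invariantPolys G m)).finrank_eq

theorem scalar_neg_one_mem_valentiner6 :
    Matrix.GeneralLinearGroup.scalar (Fin 3) (-1 : ℂˣ) ∈ valentiner6 := by
  refine ⟨?_, ?_, ?_⟩
  · rw [Matrix.mem_unitaryGroup_iff]
    simp [Matrix.star_eq_conjTranspose]
  · convert Subgroup.mem_zpowers (-1 : ℂˣ)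
    ext
    norm_num
  · rw [Matrix.ProjGenLinGroup.mk_scalar]
    exact one_mem _

theorem valentiner3_le_valentiner6 : valentiner3 ≤ valentiner6 := fun _ hT =>
  ⟨hT.1, bot_le (a := Subgroup.zpowers (-1 : ℂˣ)) hT.2.1, hT.2.2⟩

/-- In odd dimension the scalar `-1` has determinant `-1`, so it corrects the sign of the
determinant. -/
theorem exists_mem_valentiner3_of_mem_valentiner6 {T : GL (Fin 3) ℂ} (hT : T ∈ valentiner6) :
    ∃ g ∈ valentiner3, ∃ u : ℂˣ, (u : ℂ) ^ 2 = 1 ∧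
      T = g * Matrix.GeneralLinearGroup.scalar (Fin 3) u := by
  obtain ⟨hU, ⟨k, hk⟩, hV⟩ := hT
  have hs := scalar_neg_one_mem_valentiner6
  rcases Int.even_or_odd k with h | h
  · refine ⟨T, ⟨hU, ?_, hV⟩, 1, by simp, by simp⟩
    simpa [h.neg_one_zpow] using hk.symm
  · refine ⟨T * Matrix.GeneralLinearGroup.scalar (Fin 3) (-1 : ℂˣ), ⟨?_, ?_, ?_⟩, -1, by simp, ?_⟩
    · rw [Units.val_mul]
      exact mul_mem hU hs.1
    · rw [Subgroup.mem_bot, map_mul, ← hk]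
      ext
      norm_num [h.neg_one_zpow]
    · rw [map_mul]
      exact mul_mem hV hs.2.2
    · rw [mul_assoc, ← map_mul]
      simp

theorem invariantForms_valentiner6_eq_bot {p m : ℕ} (h : ¬ 2 ∣ m + p) :
    invariantForms valentiner6 p m = ⊥ := by
  refine invariantForms_eq_bot_of_scalar_mem scalar_neg_one_mem_valentiner6 ?_
  rw [Units.val_neg, Units.val_one, Odd.neg_one_pow (by grind)]
  norm_num

theorem invariantForms_valentiner6_eq {p m : ℕ} (h : 2 ∣ m + p) :
    invariantForms valentiner6 p m = invariantForms valentiner3 p m := by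
  refine le_antisymm (fun ω hω => ⟨hω.1, fun T hT => hω.2 T (valentiner3_le_valentiner6 hT)⟩)
    fun ω hω => ?_
  have h1 := (mem_invariantForms_iff (ω := ⟨ω, hω.1⟩)).1 hω
  refine (mem_invariantForms_iff (ω := ⟨ω, hω.1⟩)).2 fun T hT => ?_
  obtain ⟨g, hg, u, hu, rfl⟩ := exists_mem_valentiner3_of_mem_valentiner6 hT
  rw [map_mul, formRep_scalar h hu, mul_one, h1 g hg]

theorem map_molienSeries_valentiner6 :
    PowerSeries.map (algebraMap ℚ ℂ) (molienSeries valentiner6) =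
      residueFilter 2 0 (PowerSeries.map (algebraMap ℚ ℂ) (formSeries valentiner3 0)) := by
  ext m
  rw [coeff_residueFilter, PowerSeries.coeff_map, PowerSeries.coeff_map, molienSeries, formSeries,
    PowerSeries.coeff_mk, PowerSeries.coeff_mk, finrank_invariantPolys]
  split_ifs with h
  · rw [invariantForms_valentiner6_eq h]
  · rw [invariantForms_valentiner6_eq_bot h]
    simp

/-- The denominator is even in `t`, so taking the even part of `(1 + t⁴⁵) / D` only removes `t⁴⁵`.
-/
theorem molienDenominator_mul_molienSeries :
    molienDenominator ℚ * molienSeries valentiner6 = 1 := by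
  apply PowerSeries.map_injective (algebraMap ℚ ℂ) (algebraMap ℚ ℂ).injective
  rw [map_mul, map_molienSeries_valentiner6, map_molienDenominator,
    ← residueFilter_molienDenominator_mul _ (by norm_num), ← map_molienDenominator, ← map_mul,
    molienDenominator_mul_formSeries_zero, map_add, map_one, map_pow, PowerSeries.map_X, map_add,
    ← pow_zero PowerSeries.X, residueFilter_X_pow, residueFilter_X_pow]
  simp

theorem exteriorMolienSeries_valentiner3 : exteriorMolienSeries valentiner3 =
    Polynomial.C (formSeries valentiner3 0) +
    Polynomial.C (formSeries valentiner3 1) * Polynomial.X +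
    Polynomial.C (formSeries valentiner3 2) * Polynomial.X ^ 2 +
    Polynomial.C (formSeries valentiner3 3) * Polynomial.X ^ 3 := by
  rw [exteriorMolienSeries]
  simp only [Finset.sum_range_succ, Finset.sum_range_zero, zero_add, pow_zero, mul_one, pow_one]
  rfl

theorem inv_molienSeries : (molienSeries valentiner6)⁻¹ = molienDenominator ℚ := by
  have h := molienDenominator_mul_molienSeries
  rw [PowerSeries.inv_eq_iff_mul_eq_one, h]
  intro h0
  have := congrArg (PowerSeries.constantCoeff (R := ℚ)) h
  simp [h0] at this

theorem exteriorMolienQuotient_eq :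
    exteriorMolienQuotient = Polynomial.C (1 + PowerSeries.X ^ 45) +
      Polynomial.C (PowerSeries.X ^ 5 + PowerSeries.X ^ 11 + PowerSeries.X ^ 20 +
        PowerSeries.X ^ 26 + PowerSeries.X ^ 29 + PowerSeries.X ^ 44) * Polynomial.X +
      Polynomial.C (PowerSeries.X + PowerSeries.X ^ 16 + PowerSeries.X ^ 19 +
        PowerSeries.X ^ 25 + PowerSeries.X ^ 34 + PowerSeries.X ^ 40) * Polynomial.X ^ 2 +
      Polynomial.C (1 + PowerSeries.X ^ 45) * Polynomial.X ^ 3 := by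
  rw [exteriorMolienQuotient, inv_molienSeries, exteriorMolienSeries_valentiner3,
    ← molienDenominator_mul_formSeries_one, ← molienDenominator_mul_formSeries_two]
  -- The factor `1 + X ^ 45` stands at both `s⁰` and `s³`; both copies are rewritten, then the `s³`
  -- copy is restored and matched with 3-forms.
  conv_rhs => rw [← molienDenominator_mul_formSeries_zero]
  conv_rhs =>
    enter [2]
    rw [molienDenominator_mul_formSeries_zero, ← molienDenominator_mul_formSeries_three]
  simp only [map_mul]
  ring

end

end Valentiner

/-! ### The proposition -/

theorem mainTheorem5 :
    -- the division is legitimate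
    IsUnit (Valentiner.molienSeries Valentiner.valentiner6) ∧
    -- the value of the quotient, with `t = PowerSeries.X` and `s = Polynomial.X`
    (let t : PowerSeries ℚ := PowerSeries.X
     let s : Polynomial (PowerSeries ℚ) := Polynomial.X
     Valentiner.exteriorMolienQuotient =
      Polynomial.C (1 + t ^ 45) +
      Polynomial.C (t ^ 5 + t ^ 11 + t ^ 20 + t ^ 26 + t ^ 29 + t ^ 44) * s +
      Polynomial.C (t + t ^ 16 + t ^ 19 + t ^ 25 + t ^ 34 + t ^ 40) * s ^ 2 +
      Polynomial.C (1 + t ^ 45) * s ^ 3) ∧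
    -- duality: the coefficients of `s ^ p * t ^ a` and `s ^ (3 - p) * t ^ (45 - a)` agree
    (∀ p q a b : ℕ, p + q = 3 → a + b = 45 →
      PowerSeries.coeff a (Valentiner.exteriorMolienQuotient.coeff p) =
        PowerSeries.coeff b (Valentiner.exteriorMolienQuotient.coeff q)) := by
  refine ⟨IsUnit.of_mul_eq_one _
    ((mul_comm _ _).trans Valentiner.molienDenominator_mul_molienSeries),
    Valentiner.exteriorMolienQuotient_eq, ?_⟩
  intro p q a b hpq hab
  rw [Valentiner.exteriorMolienQuotient_eq]
  obtain rfl : b = 45 - a := by omega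
  obtain rfl : q = 3 - p := by omega
  have hp : p ≤ 3 := by omega
  have ha : a ≤ 45 := by omega
  simp only [Polynomial.coeff_add, Polynomial.coeff_C_mul, Polynomial.coeff_X_pow,
    Polynomial.coeff_C, Polynomial.coeff_X]
  -- The duality is a finite check over `p ≤ 3` and `a ≤ 45`.
  interval_cases p <;> simp [PowerSeries.coeff_X_pow, PowerSeries.coeff_one, PowerSeries.coeff_X]
  all_goals interval_cases a <;> simp
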